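/- Let $n\ge 1$ and $m,p\ge 0$ be integers, let $A\in\mathbb R^{n\times n}$, $C\in\mathbb R^{p\times n}$, $G\in\mathbb R^{n\times m}$, $H\in\mathbb R^{p\times p}$ be constant matrices with $HH'$ invertible (a prime denotes the transpose), and put $$\Phi(P)=AP+PA'+GG'-PC'(HH')^{-1}CP .$$ Assume that $(A,C)$ is observable, i.e. the matrix with block rows $C,CA,\dots,CA^{n-1}$ has rank $n$, and that $G$ has rank $n$. Let $P_+(n)$ be the set of symmetric positive definite real $n\times n$ matrices with the natural distance $$d(P,Q)=\Big(\sum_{i=1}^n\log^2\lambda_i\Big)^{1/2},\qquad \lambda_1,\dots,\lambda_n \text{ the eigenvalues of } PQ^{-1}.$$ Then: 1. The equation $\Phi(Q)=0$ has a unique solution $Q$ in $P_+(n)$. 2. For every $P_0\in P_+(n)$ the Riccati equation $\dot P=\Phi(P)$ has a solution on $[0,\infty)$ with $P(0)=P_0$. 3. The lowest eigenvalue $\mu$ of $GG'$ is positive. For $R\in P_+(n)$ let $S_R=\{P\in P_+(n): d(Q,P)\le d(Q,R)\}$ and $M_R=\sup\{\|P\|_2: P\in S_R\}$, where $\|\cdot\|_2$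 is the spectral norm. Then $0<M_R<\infty$, and for any two matrix-valued solutions $P_1,P_2$ of $\dot P=\Phi(P)$ on an interval $J\subseteq[0,\infty)$ containing $0$ with $P_1(0),P_2(0)\in S_R$, one has for all $t\in J$ that $P_1(t),P_2(t)\in S_R$ and $$d(P_1(t),P_2(t))\le e^{-\frac{\mu}{M_R}t}\,d(P_1(0),P_2(0)).$$ 4. Every solution $P$ of $\dot P=\Phi(P)$ on $[0,\infty)$ with $P(0)\in P_+(n)$ stays in $P_+(n)$ and converges exponentially to $Q$: there is $\kappa>0$ such that $d(P(t),Q)\le e^{-\kappa t}d(P(0),Q)$ for all $t\ge 0$. -/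

import Mathlib

noncomputable section

namespace KalmanRiccati

open Matrix

/-- `P_+(n)`: the cone of real symmetric positive definite `n × n` matrices. -/
def posCone (n : ℕ) : Set (Matrix (Fin n) (Fin n) ℝ) :=
  {P | P.PosDef}

/-- The right-hand side of the Riccati equation,
`Φ(P) = A P + P A' + G G' - P C' (H H')⁻¹ C P`. -/
def riccati {n m p : ℕ} (A : Matrix (Fin n) (Fin n) ℝ) (C : Matrix (Fin p) (Fin n) ℝ)
    (G : Matrix (Fin n) (Fin m) ℝ) (H : Matrix (Fin p) (Fin p) ℝ)
    (P : Matrix (Fin n) (Fin n) ℝ) : Matrix (Fin n) (Fin n) ℝ :=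
  A * P + P * Aᵀ + G * Gᵀ - P * Cᵀ * (H * Hᵀ)⁻¹ * C * P

/-- The matrix curve `P` solves `Ṗ = Φ(P)` on the time set `J` (derivatives, relative to `J`,
are taken entry by entry). The values of `P` are not required to lie in `P_+(n)`. -/
def IsRiccatiSolutionOn {n m p : ℕ} (A : Matrix (Fin n) (Fin n) ℝ)
    (C : Matrix (Fin p) (Fin n) ℝ) (G : Matrix (Fin n) (Fin m) ℝ)
    (H : Matrix (Fin p) (Fin p) ℝ) (P : ℝ → Matrix (Fin n) (Fin n) ℝ) (J : Set ℝ) : Prop :=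
  ∀ t ∈ J, ∀ i j, HasDerivWithinAt (fun s => P s i j) (riccati A C G H (P t) i j) J t

/-- The observability matrix, with block rows `C, C A, …, C A^(n-1)`. -/
def observabilityMatrix {n p : ℕ} (A : Matrix (Fin n) (Fin n) ℝ)
    (C : Matrix (Fin p) (Fin n) ℝ) : Matrix (Fin n × Fin p) (Fin n) ℝ :=
  Matrix.of fun k j => (C * A ^ (k.1 : ℕ)) k.2 j

/-- The pair `(A, C)` is observable: the observability matrix has rank `n`. -/
def IsObservable {n p : ℕ} (A : Matrix (Fin n) (Fin n) ℝ)
    (C : Matrix (Fin p) (Fin n) ℝ) : Prop :=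
  (observabilityMatrix A C).rank = n

/-- The natural distance `(∑ log² λᵢ)^(1/2)` on `P_+(n)`, where the `λᵢ` are the eigenvalues of
`P Q⁻¹` counted with multiplicity. For `P, Q ∈ P_+(n)` the characteristic polynomial of `P Q⁻¹`
has `n` positive real roots. -/
def natDist {n : ℕ} (P Q : Matrix (Fin n) (Fin n) ℝ) : ℝ :=
  Real.sqrt (((P * Q⁻¹).charpoly.roots.map fun l => Real.log l ^ 2).sum)

/-- The ball `S_R` of `P_+(n)` with center `Q` and radius the natural distance from `Q` to `R`. -/
def ballThrough {n : ℕ} (Q R : Matrix (Fin n) (Fin n) ℝ) : Set (Matrix (Fin n) (Fin n) ℝ) :=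
  {P | P ∈ posCone n ∧ natDist Q P ≤ natDist Q R}

/-- The norm `‖P‖₂`: operator norm for the Euclidean norm on `ℝⁿ`. -/
def norm2 {n : ℕ} (P : Matrix (Fin n) (Fin n) ℝ) : ℝ :=
  ‖Matrix.toEuclideanCLM (n := Fin n) (𝕜 := ℝ) P‖

end KalmanRiccati

end

/-! Write `N = GG'` and `K = C'(HH')⁻¹C`. The Riccati equation is the projection of a linear
Hamiltonian system: if `X' = -AᵀX + KY` and `Y' = NX + AY`, then `P = Y X⁻¹` solves it wherever `X`
is invertible. The form `XᵀY` has derivative `YᵀKY + XᵀNX ≥ 0`, so if it starts positive definite it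
remains so. Hence `X` stays invertible for `t ≥ 0`: solutions starting in the cone exist for all
time and stay positive definite. Any other solution with the same initial value agrees with the
quotient, by Grönwall.

For contraction, put `T = P₁P₂⁻¹`. Then `T' = [A,T] + (1-T)NP₂⁻¹ + P₁K(1-T)`, and the squared
distance is formally `tr log²T`. The commutator drops out of its derivative. Diagonalizing `P₁` and
`P₂` simultaneously leaves `∑ (2 log λᵢ/λᵢ)(1-λᵢ)wᵢ`, where `wᵢ ≥ c·max(1,λᵢ)` as soon as `N ≥ cP₁`
and `N ≥ cP₂`. Elementary inequalities for `log` bound the sum by `-2c` times the squared distance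
(`natDist_le_exp_mul`). To avoid differentiating eigenvalues, `log²` is replaced by polynomials
close to it in `C¹`, and the error is sent to zero after integration.

With `c = 0` this makes balls around the equilibrium invariant. On such a ball `P ≤ M·1`, while `N ≥
μ·1`, so `c = μ/M` is admissible. Uniqueness of the equilibrium and exponential convergence follow.

Existence of the equilibrium is where observability enters. A finite-time Gramian gives `Z > 0` with
`AᵀZ + ZA + Z ≤ K`, and a multiple of `Z⁻¹` is then a supersolution, `Φ ≤ 0`. The flow preserves `Φ
≤ 0` and does not increase the trace, so a supersolution of least trace must be stationary. -/

namespace KalmanRiccati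

open Matrix Set

variable {n m p : ℕ}

/-! ### Calculus of matrix curves. -/

section Calculus

open scoped Matrix.Norms.Operator

theorem hasDerivWithinAt_matrix {P : ℝ → Matrix (Fin n) (Fin n) ℝ} {P' : Matrix (Fin n) (Fin n) ℝ}
    {J : Set ℝ} {t : ℝ} :
    HasDerivWithinAt P P' J t ↔ ∀ i j, HasDerivWithinAt (fun s => P s i j) (P' i j) J t := by
  refine (hasDerivWithinAt_pi (φ := P) (φ' := P')).trans ?_
  exact forall_congr' fun i => hasDerivWithinAt_pi

theorem hasDerivWithinAt_linear {E F : Type*} [NormedAddCommGroup E] [NormedSpace ℝ E]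
    [FiniteDimensional ℝ E] [NormedAddCommGroup F] [NormedSpace ℝ F] (L : E →ₗ[ℝ] F)
    {f : ℝ → E} {f' : E} {J : Set ℝ} {t : ℝ} (h : HasDerivWithinAt f f' J t) :
    HasDerivWithinAt (fun s => L (f s)) (L f') J t :=
  (LinearMap.toContinuousLinearMap L).hasFDerivAt.comp_hasDerivWithinAt t h

theorem hasDerivWithinAt_transpose {P : ℝ → Matrix (Fin n) (Fin n) ℝ}
    {P' : Matrix (Fin n) (Fin n) ℝ} {J : Set ℝ} {t : ℝ} (h : HasDerivWithinAt P P' J t) :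
    HasDerivWithinAt (fun s => (P s)ᵀ) P'ᵀ J t :=
  hasDerivWithinAt_linear (Matrix.transposeLinearEquiv (Fin n) (Fin n) ℝ ℝ).toLinearMap h

theorem hasDerivWithinAt_inv {P : ℝ → Matrix (Fin n) (Fin n) ℝ}
    {P' : Matrix (Fin n) (Fin n) ℝ} {J : Set ℝ} {t : ℝ} (h : HasDerivWithinAt P P' J t)
    (hu : IsUnit (P t)) :
    HasDerivWithinAt (fun s => (P s)⁻¹) (-((P t)⁻¹ * P' * (P t)⁻¹)) J t := by
  obtain ⟨u, hu⟩ := hu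
  have h1 := hasFDerivAt_ringInverse (𝕜 := ℝ) u
  rw [hu] at h1
  have h2 := h1.comp_hasDerivWithinAt t h
  have h3 : ((u⁻¹ : (Matrix (Fin n) (Fin n) ℝ)ˣ) : Matrix (Fin n) (Fin n) ℝ) = (P t)⁻¹ := by
    rw [← hu, Matrix.coe_units_inv]
  simp only [_root_.neg_apply, ContinuousLinearMap.mulLeftRight_apply, h3] at h2
  refine h2.congr_deriv rfl |>.congr (fun x _ => ?_) ?_ <;>
    simp [Matrix.nonsing_inv_eq_ringInverse]

/-! ### The Hamiltonian system and its conserved quantities. -/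

/-- A solution of the linear Hamiltonian system whose quotient `Y X⁻¹` solves the Riccati
equation. -/
structure IsHamiltonianFlow (A N K : Matrix (Fin n) (Fin n) ℝ)
    (X Y : ℝ → Matrix (Fin n) (Fin n) ℝ) : Prop where
  deriv_fst : ∀ t, HasDerivAt X (-Aᵀ * X t + K * Y t) t
  deriv_snd : ∀ t, HasDerivAt Y (N * X t + A * Y t) t

theorem exists_linear_flow {E : Type*} [NormedAddCommGroup E] [NormedSpace ℝ E] [CompleteSpace E]
    (L : E →L[ℝ] E) (z₀ : E) : ∃ z : ℝ → E, z 0 = z₀ ∧ ∀ t, HasDerivAt z (L (z t)) t := by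
  refine ⟨fun t => NormedSpace.exp (t • L) z₀, by simp, fun t => ?_⟩
  exact (hasDerivAt_exp_smul_const' L t).clm_apply (hasDerivAt_const t z₀) |>.congr_deriv (by simp)

theorem exists_isHamiltonianFlow (A N K X₀ Y₀ : Matrix (Fin n) (Fin n) ℝ) :
    ∃ X Y, IsHamiltonianFlow A N K X Y ∧ X 0 = X₀ ∧ Y 0 = Y₀ := by
  let E := Matrix (Fin n) (Fin n) ℝ × Matrix (Fin n) (Fin n) ℝ
  let L₀ : E →ₗ[ℝ] E := LinearMap.prod
    (LinearMap.mulLeft ℝ (-Aᵀ) ∘ₗ LinearMap.fst ℝ _ _ + LinearMap.mulLeft ℝ K ∘ₗ LinearMap.snd ℝ _ _)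
    (LinearMap.mulLeft ℝ N ∘ₗ LinearMap.fst ℝ _ _ + LinearMap.mulLeft ℝ A ∘ₗ LinearMap.snd ℝ _ _)
  obtain ⟨z, hz0, hz⟩ := exists_linear_flow (LinearMap.toContinuousLinearMap L₀) (X₀, Y₀)
  refine ⟨fun t => (z t).1, fun t => (z t).2, ⟨fun t => ?_, fun t => ?_⟩, ?_, ?_⟩
  · exact (ContinuousLinearMap.fst ℝ _ _).hasFDerivAt.comp_hasDerivAt t (hz t)
  · exact (ContinuousLinearMap.snd ℝ _ _).hasFDerivAt.comp_hasDerivAt t (hz t)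
  · simp [hz0]
  · simp [hz0]

theorem eq_of_hasDerivAt_zero {f : ℝ → Matrix (Fin n) (Fin n) ℝ} (h : ∀ t, HasDerivAt f 0 t)
    (t : ℝ) : f t = f 0 :=
  is_const_of_deriv_eq_zero (fun t => (h t).differentiableAt) (fun t => (h t).deriv) t 0

theorem hasDerivAt_transpose {P : ℝ → Matrix (Fin n) (Fin n) ℝ}
    {P' : Matrix (Fin n) (Fin n) ℝ} {t : ℝ} (h : HasDerivAt P P' t) :
    HasDerivAt (fun s => (P s)ᵀ) P'ᵀ t := by
  exact hasDerivWithinAt_univ.1 (hasDerivWithinAt_transpose (hasDerivWithinAt_univ.2 h))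

namespace IsHamiltonianFlow

variable {A N K : Matrix (Fin n) (Fin n) ℝ} {X Y : ℝ → Matrix (Fin n) (Fin n) ℝ}

/-- The difference of the two sides is the symplectic form on the columns of the solution, and the
flow conserves it. It gives the symmetry of `Y X⁻¹`. -/
theorem transpose_mul_comm (h : IsHamiltonianFlow A N K X Y) (hN : Nᵀ = N) (hK : Kᵀ = K)
    (h0 : (X 0)ᵀ * Y 0 = (Y 0)ᵀ * X 0) (t : ℝ) : (X t)ᵀ * Y t = (Y t)ᵀ * X t := by
  have := eq_of_hasDerivAt_zero (f := fun t => (X t)ᵀ * Y t - (Y t)ᵀ * X t) (fun t => by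
    refine (((hasDerivAt_transpose (h.deriv_fst t)).mul (h.deriv_snd t)).sub
      ((hasDerivAt_transpose (h.deriv_snd t)).mul (h.deriv_fst t))).congr_deriv ?_
    simp only [transpose_add, transpose_mul, transpose_neg, transpose_transpose, hN, hK]
    noncomm_ring) t
  simp only [h0, sub_self] at this
  exact sub_eq_zero.1 this

theorem hasDerivAt_transpose_mul (h : IsHamiltonianFlow A N K X Y) (hK : Kᵀ = K) (t : ℝ) :
    HasDerivAt (fun t => (X t)ᵀ * Y t) ((Y t)ᵀ * K * Y t + (X t)ᵀ * N * X t) t := by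
  refine ((hasDerivAt_transpose (h.deriv_fst t)).mul (h.deriv_snd t)).congr_deriv ?_
  simp only [transpose_add, transpose_mul, transpose_neg, transpose_transpose, hK]
  noncomm_ring

/-- The conserved quantity is the quadratic Hamiltonian. On `Y = PX` with `P` symmetric it reads `Xᵀ
Φ(P) X`, so the sign of `Φ` is preserved along the flow. -/
theorem energy_eq (h : IsHamiltonianFlow A N K X Y) (hN : Nᵀ = N) (hK : Kᵀ = K) (t : ℝ) :
    (X t)ᵀ * N * X t + (X t)ᵀ * A * Y t + (Y t)ᵀ * Aᵀ * X t - (Y t)ᵀ * K * Y t =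
    (X 0)ᵀ * N * X 0 + (X 0)ᵀ * A * Y 0 + (Y 0)ᵀ * Aᵀ * X 0 - (Y 0)ᵀ * K * Y 0 := by
  refine eq_of_hasDerivAt_zero (f := fun t => (X t)ᵀ * N * X t + (X t)ᵀ * A * Y t +
    (Y t)ᵀ * Aᵀ * X t - (Y t)ᵀ * K * Y t) (fun t => ?_) t
  have hX := h.deriv_fst t
  have hY := h.deriv_snd t
  have hX' := hasDerivAt_transpose hX
  have hY' := hasDerivAt_transpose hY
  refine (((((hX'.mul_const N).mul hX).add ((hX'.mul_const A).mul hY)).add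
    ((hY'.mul_const Aᵀ).mul hX)).sub ((hY'.mul_const K).mul hY)).congr_deriv ?_
  simp only [transpose_add, transpose_mul, transpose_neg, transpose_transpose, hN, hK]
  noncomm_ring

end IsHamiltonianFlow

end Calculus

/-! ### Positivity, and the Riccati flow as a quotient. -/

theorem posSemidef_iff {M : Matrix (Fin n) (Fin n) ℝ} :
    M.PosSemidef ↔ Mᵀ = M ∧ ∀ x, 0 ≤ x ⬝ᵥ (M *ᵥ x) := by
  simp [posSemidef_iff_dotProduct_mulVec, IsHermitian, conjTranspose_eq_transpose_of_trivial]

theorem posDef_iff {M : Matrix (Fin n) (Fin n) ℝ} :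
    M.PosDef ↔ Mᵀ = M ∧ ∀ x, x ≠ 0 → 0 < x ⬝ᵥ (M *ᵥ x) := by
  simp [posDef_iff_dotProduct_mulVec, IsHermitian, conjTranspose_eq_transpose_of_trivial]

theorem dotProduct_conj (B M : Matrix (Fin n) (Fin n) ℝ) (x : Fin n → ℝ) :
    x ⬝ᵥ ((Bᵀ * M * B) *ᵥ x) = (B *ᵥ x) ⬝ᵥ (M *ᵥ (B *ᵥ x)) := by
  rw [← mulVec_mulVec, ← mulVec_mulVec, dotProduct_mulVec, vecMul_transpose]

theorem posSemidef_conj {M : Matrix (Fin n) (Fin n) ℝ} (h : M.PosSemidef)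
    (B : Matrix (Fin n) (Fin n) ℝ) : (Bᵀ * M * B).PosSemidef := by
  simpa [conjTranspose_eq_transpose_of_trivial] using h.conjTranspose_mul_mul_same B

theorem posDef_conj {M : Matrix (Fin n) (Fin n) ℝ} (h : M.PosDef)
    {B : Matrix (Fin n) (Fin n) ℝ} (hB : IsUnit B) : (Bᵀ * M * B).PosDef := by
  simpa [conjTranspose_eq_transpose_of_trivial] using
    h.conjTranspose_mul_mul_same (mulVec_injective_of_isUnit hB)

section Calculus

open scoped Matrix.Norms.Operator

theorem hasDerivWithinAt_dotProduct {P : ℝ → Matrix (Fin n) (Fin n) ℝ}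
    {P' : Matrix (Fin n) (Fin n) ℝ} {J : Set ℝ} {t : ℝ} (h : HasDerivWithinAt P P' J t)
    (x : Fin n → ℝ) :
    HasDerivWithinAt (fun s => x ⬝ᵥ (P s *ᵥ x)) (x ⬝ᵥ (P' *ᵥ x)) J t :=
  hasDerivWithinAt_linear
    { toFun := fun M : Matrix (Fin n) (Fin n) ℝ => x ⬝ᵥ (M *ᵥ x)
      map_add' := fun M N => by rw [add_mulVec, dotProduct_add]
      map_smul' := fun c M => by simp [smul_mulVec] } h

theorem hasDerivWithinAt_trace {P : ℝ → Matrix (Fin n) (Fin n) ℝ}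
    {P' : Matrix (Fin n) (Fin n) ℝ} {J : Set ℝ} {t : ℝ} (h : HasDerivWithinAt P P' J t) :
    HasDerivWithinAt (fun s => (P s).trace) P'.trace J t :=
  hasDerivWithinAt_linear (traceLinearMap (Fin n) ℝ ℝ) h

namespace IsHamiltonianFlow

variable {A N K : Matrix (Fin n) (Fin n) ℝ} {X Y : ℝ → Matrix (Fin n) (Fin n) ℝ}

theorem hasDerivAt_form (h : IsHamiltonianFlow A N K X Y) (hK : Kᵀ = K) (x : Fin n → ℝ) (t : ℝ) :
    HasDerivAt (fun t => x ⬝ᵥ (((X t)ᵀ * Y t) *ᵥ x))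
      ((Y t *ᵥ x) ⬝ᵥ (K *ᵥ (Y t *ᵥ x)) + (X t *ᵥ x) ⬝ᵥ (N *ᵥ (X t *ᵥ x))) t := by
  have := hasDerivWithinAt_dotProduct
    (hasDerivWithinAt_univ.2 (h.hasDerivAt_transpose_mul hK t)) x
  rw [add_mulVec, dotProduct_add, dotProduct_conj, dotProduct_conj] at this
  exact hasDerivWithinAt_univ.1 this

theorem monotone_form (h : IsHamiltonianFlow A N K X Y) (hN : N.PosSemidef) (hK : K.PosSemidef)
    (x : Fin n → ℝ) : Monotone (fun t => x ⬝ᵥ (((X t)ᵀ * Y t) *ᵥ x)) :=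
  monotone_of_hasDerivAt_nonneg (h.hasDerivAt_form (posSemidef_iff.1 hK).1 x) fun _ =>
    add_nonneg ((posSemidef_iff.1 hK).2 _) ((posSemidef_iff.1 hN).2 _)

/-- The form equals `Y 0` at time zero and never decreases. This rules out blow-up, since it forces
`X t` to be invertible. -/
theorem posDef_transpose_mul (h : IsHamiltonianFlow A N K X Y) (hN : N.PosSemidef)
    (hK : K.PosSemidef) (hX : X 0 = 1) (hY : (Y 0).PosDef) {t : ℝ} (ht : 0 ≤ t) :
    ((X t)ᵀ * Y t).PosDef := by
  have hYs := (posDef_iff.1 hY).1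
  refine posDef_iff.2 ⟨?_, fun x hx => ?_⟩
  · rw [transpose_mul, transpose_transpose, h.transpose_mul_comm (posSemidef_iff.1 hN).1
      (posSemidef_iff.1 hK).1 (by simp [hX, hYs])]
  · refine lt_of_lt_of_le ?_ (h.monotone_form hN hK x ht)
    simpa [hX] using (posDef_iff.1 hY).2 x hx

theorem isUnit_fst {t : ℝ} (h : ((X t)ᵀ * Y t).PosDef) : IsUnit (X t) := by
  have := h.isUnit
  rw [Matrix.isUnit_iff_isUnit_det, det_mul, det_transpose] at this
  exact (Matrix.isUnit_iff_isUnit_det _).2 (isUnit_of_mul_isUnit_left this)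

theorem posDef_quotient {t : ℝ} (h : ((X t)ᵀ * Y t).PosDef) : (Y t * (X t)⁻¹).PosDef := by
  have hu := isUnit_fst h
  have hu' := (Matrix.isUnit_iff_isUnit_det _).1 hu
  have := posDef_conj h (B := (X t)⁻¹) ((Matrix.isUnit_nonsing_inv_iff).2 hu)
  rwa [← mul_assoc, ← transpose_mul, mul_nonsing_inv _ hu', transpose_one, one_mul] at this

theorem hasDerivAt_quotient (h : IsHamiltonianFlow A N K X Y) {t : ℝ} (hu : IsUnit (X t)) :
    HasDerivAt (fun s => Y s * (X s)⁻¹)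
      (A * (Y t * (X t)⁻¹) + (Y t * (X t)⁻¹) * Aᵀ + N - (Y t * (X t)⁻¹) * K * (Y t * (X t)⁻¹)) t := by
  have hu' := (Matrix.isUnit_iff_isUnit_det _).1 hu
  have h1 := hasDerivWithinAt_univ.1
    (hasDerivWithinAt_inv (hasDerivWithinAt_univ.2 (h.deriv_fst t)) hu)
  refine ((h.deriv_snd t).mul h1).congr_deriv ?_
  have h2 : (N * X t + A * Y t) * (X t)⁻¹ = N + A * (Y t * (X t)⁻¹) := by
    rw [add_mul, mul_assoc, mul_nonsing_inv _ hu', mul_one, mul_assoc]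
  have h3 : (-Aᵀ * X t + K * Y t) * (X t)⁻¹ = -Aᵀ + K * (Y t * (X t)⁻¹) := by
    rw [add_mul, mul_assoc, mul_nonsing_inv _ hu', mul_one, mul_assoc]
  rw [h2, mul_assoc (X t)⁻¹, h3]
  noncomm_ring

/-- The Riccati expression of the quotient is congruent to its initial value. -/
theorem quotient_riccati (h : IsHamiltonianFlow A N K X Y) (hN : Nᵀ = N) (hK : Kᵀ = K)
    {t : ℝ} (hX : X 0 = 1) (hYs : (Y 0)ᵀ = Y 0) (hu : IsUnit (X t)) :
    A * (Y t * (X t)⁻¹) + (Y t * (X t)⁻¹) * Aᵀ + N - (Y t * (X t)⁻¹) * K * (Y t * (X t)⁻¹) =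
      ((X t)⁻¹)ᵀ * (A * Y 0 + Y 0 * Aᵀ + N - Y 0 * K * Y 0) * (X t)⁻¹ := by
  have hu' := (Matrix.isUnit_iff_isUnit_det _).1 hu
  have he := h.energy_eq hN hK t
  have hc := h.transpose_mul_comm hN hK (by simp [hX, hYs]) t
  simp only [hX, hYs, transpose_one, one_mul, mul_one] at he
  have hi : X t * (X t)⁻¹ = 1 := mul_nonsing_inv _ hu'
  have hj : ((X t)⁻¹)ᵀ * (X t)ᵀ = 1 := by rw [← transpose_mul, hi, transpose_one]
  -- This is the symmetry of `Y X⁻¹`.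
  have hq : ((X t)⁻¹)ᵀ * (Y t)ᵀ = Y t * (X t)⁻¹ := by
    calc ((X t)⁻¹)ᵀ * (Y t)ᵀ = ((X t)⁻¹)ᵀ * ((Y t)ᵀ * X t) * (X t)⁻¹ := by
          rw [mul_assoc, mul_assoc, hi, mul_one]
      _ = _ := by rw [← hc, ← mul_assoc, hj, one_mul]
  have he' : A * Y 0 + Y 0 * Aᵀ + N - Y 0 * K * Y 0 =
      (X t)ᵀ * N * X t + (X t)ᵀ * A * Y t + (Y t)ᵀ * Aᵀ * X t - (Y t)ᵀ * K * Y t := by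
    rw [he]; abel
  rw [he', mul_sub, mul_add, mul_add, sub_mul, add_mul, add_mul]
  have e1 : ((X t)⁻¹)ᵀ * ((X t)ᵀ * N * X t) * (X t)⁻¹ = N := by
    calc _ = (((X t)⁻¹)ᵀ * (X t)ᵀ) * N * (X t * (X t)⁻¹) := by noncomm_ring
      _ = N := by rw [hi, hj, one_mul, mul_one]
  have e2 : ((X t)⁻¹)ᵀ * ((X t)ᵀ * A * Y t) * (X t)⁻¹ = A * (Y t * (X t)⁻¹) := by
    calc _ = (((X t)⁻¹)ᵀ * (X t)ᵀ) * A * (Y t * (X t)⁻¹) := by noncomm_ring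
      _ = _ := by rw [hj, one_mul]
  have e3 : ((X t)⁻¹)ᵀ * ((Y t)ᵀ * Aᵀ * X t) * (X t)⁻¹ = (Y t * (X t)⁻¹) * Aᵀ := by
    calc _ = (((X t)⁻¹)ᵀ * (Y t)ᵀ) * Aᵀ * (X t * (X t)⁻¹) := by noncomm_ring
      _ = _ := by rw [hi, hq, mul_one]
  have e4 : ((X t)⁻¹)ᵀ * ((Y t)ᵀ * K * Y t) * (X t)⁻¹ =
      (Y t * (X t)⁻¹) * K * (Y t * (X t)⁻¹) := by
    calc _ = (((X t)⁻¹)ᵀ * (Y t)ᵀ) * K * (Y t * (X t)⁻¹) := by noncomm_ring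
      _ = _ := by rw [hq]
  rw [e1, e2, e3, e4]
  abel

end IsHamiltonianFlow

/-- A solution of the Riccati equation is the quotient of the Hamiltonian flow with the same
initial value. -/
theorem eq_quotient_of_hasDerivWithinAt {A N K : Matrix (Fin n) (Fin n) ℝ}
    {X Y P : ℝ → Matrix (Fin n) (Fin n) ℝ} (h : IsHamiltonianFlow A N K X Y) (hX : X 0 = 1)
    {b : ℝ} (hP0 : P 0 = Y 0)
    (hP : ∀ t ∈ Icc 0 b,
      HasDerivWithinAt P (A * P t + P t * Aᵀ + N - P t * K * P t) (Icc 0 b) t)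
    {t : ℝ} (ht : t ∈ Icc 0 b) (hu : IsUnit (X t)) : P t = Y t * (X t)⁻¹ := by
  have hPc : ContinuousOn P (Icc 0 b) := fun s hs => (hP s hs).continuousWithinAt
  obtain ⟨c, hc⟩ := isCompact_Icc.exists_bound_of_continuousOn
    (f := fun s => A - P s * K) (continuousOn_const.sub (hPc.mul continuousOn_const))
  -- The defect `Y - PX` solves a homogeneous linear equation with bounded coefficient and starts at
  -- zero. Invertibility of `X` is needed only at the final time.
  have hD : ∀ s ∈ Icc 0 b, HasDerivWithinAt (fun s => Y s - P s * X s)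
      ((A - P s * K) * (Y s - P s * X s)) (Icc 0 b) s := fun s hs => by
    refine ((h.deriv_snd s).hasDerivWithinAt.sub
      ((hP s hs).mul (h.deriv_fst s).hasDerivWithinAt)).congr_deriv ?_
    noncomm_ring
  have hz := eq_zero_of_abs_deriv_le_mul_abs_self_of_eq_zero_right (K := c)
    (f := fun s => Y s - P s * X s) (a := 0) (b := b)
    (fun s hs => (hD s hs).continuousWithinAt)
    (fun s hs => (hD s (Ico_subset_Icc_self hs)).mono_of_mem_nhdsWithin
      (Icc_mem_nhdsGE_of_mem hs))
    (by simp [hX, hP0])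
    (fun s hs => (norm_mul_le _ _).trans
      (mul_le_mul_of_nonneg_right (hc s (Ico_subset_Icc_self hs)) (norm_nonneg _))) t ht
  have hu' := (Matrix.isUnit_iff_isUnit_det _).1 hu
  rw [sub_eq_zero.1 hz, mul_assoc, mul_nonsing_inv _ hu', mul_one]

end Calculus

/-! ### Simultaneous diagonalization and the natural distance. -/

/-- `W` brings the quadratic forms `Q` and `P` to the identity and to `diagonal l`. -/
structure IsSimDiag (P Q W : Matrix (Fin n) (Fin n) ℝ) (l : Fin n → ℝ) : Prop where
  isUnit : IsUnit W
  pos : ∀ i, 0 < l i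
  right_eq : Q = W * Wᵀ
  left_eq : P = W * diagonal l * Wᵀ

theorem exists_orthogonal_diagonal {M : Matrix (Fin n) (Fin n) ℝ} (hM : M.IsHermitian) :
    ∃ U : Matrix (Fin n) (Fin n) ℝ, U * Uᵀ = 1 ∧ Uᵀ * U = 1 ∧
      M = U * diagonal hM.eigenvalues * Uᵀ := by
  refine ⟨hM.eigenvectorUnitary, ?_, ?_, ?_⟩
  · exact Unitary.mul_star_self_of_mem hM.eigenvectorUnitary.2
  · exact Unitary.star_mul_self_of_mem hM.eigenvectorUnitary.2
  · exact hM.spectral_theorem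

theorem exists_eq_mul_transpose {Q : Matrix (Fin n) (Fin n) ℝ} (hQ : Q.PosDef) :
    ∃ B : Matrix (Fin n) (Fin n) ℝ, IsUnit B ∧ Q = B * Bᵀ := by
  obtain ⟨U, h1, -, hU⟩ := exists_orthogonal_diagonal hQ.1
  have hd : diagonal hQ.1.eigenvalues = diagonal (fun i => √(hQ.1.eigenvalues i)) *
      (diagonal fun i => √(hQ.1.eigenvalues i))ᵀ := by
    rw [diagonal_transpose, diagonal_mul_diagonal]
    congr 1
    ext i
    exact (Real.mul_self_sqrt (hQ.eigenvalues_pos i).le).symm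
  refine ⟨U * diagonal fun i => √(hQ.1.eigenvalues i), ?_, ?_⟩
  · refine (IsUnit.of_mul_eq_one _ h1).mul ?_
    rw [isUnit_diagonal, Pi.isUnit_iff]
    exact fun i => (Real.sqrt_pos.2 (hQ.eigenvalues_pos i)).ne'.isUnit
  · conv_lhs => rw [hU, hd]
    simp only [transpose_mul, mul_assoc]

theorem exists_isSimDiag {P Q : Matrix (Fin n) (Fin n) ℝ} (hP : P.PosDef) (hQ : Q.PosDef) :
    ∃ W l, IsSimDiag P Q W l := by
  obtain ⟨B, hB, hQB⟩ := exists_eq_mul_transpose hQ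
  have hB' := (isUnit_iff_isUnit_det _).1 hB
  have hM : (B⁻¹ * P * (B⁻¹)ᵀ).PosDef := by
    simpa using posDef_conj hP (B := (B⁻¹)ᵀ) (by simpa using hB)
  obtain ⟨U, h1, -, hU⟩ := exists_orthogonal_diagonal hM.1
  refine ⟨B * U, hM.1.eigenvalues, hB.mul (IsUnit.of_mul_eq_one _ h1), hM.eigenvalues_pos, ?_, ?_⟩
  · calc Q = B * (U * Uᵀ) * Bᵀ := by rw [h1, mul_one, hQB]
      _ = _ := by simp only [transpose_mul, mul_assoc]
  · have hi : B * B⁻¹ = 1 := mul_nonsing_inv _ hB'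
    have hj : (B⁻¹)ᵀ * Bᵀ = 1 := by rw [← transpose_mul, hi, transpose_one]
    calc P = (B * B⁻¹) * P * ((B⁻¹)ᵀ * Bᵀ) := by rw [hi, hj, one_mul, mul_one]
      _ = B * (B⁻¹ * P * (B⁻¹)ᵀ) * Bᵀ := by simp only [mul_assoc]
      _ = B * (U * diagonal hM.1.eigenvalues * Uᵀ) * Bᵀ := by rw [← hU]
      _ = _ := by simp only [transpose_mul, mul_assoc]

namespace IsSimDiag

variable {P Q W : Matrix (Fin n) (Fin n) ℝ} {l : Fin n → ℝ}

theorem mul_inv_cancel (h : IsSimDiag P Q W l) : W * W⁻¹ = 1 :=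
  mul_nonsing_inv _ ((isUnit_iff_isUnit_det _).1 h.isUnit)

theorem inv_mul_cancel (h : IsSimDiag P Q W l) : W⁻¹ * W = 1 :=
  nonsing_inv_mul _ ((isUnit_iff_isUnit_det _).1 h.isUnit)

theorem transpose_mul_inv (h : IsSimDiag P Q W l) : Wᵀ * (W⁻¹)ᵀ = 1 := by
  rw [← transpose_mul, h.inv_mul_cancel, transpose_one]

theorem inv_eq (h : IsSimDiag P Q W l) : Q⁻¹ = (W⁻¹)ᵀ * W⁻¹ := by
  rw [h.right_eq, Matrix.mul_inv_rev, transpose_nonsing_inv]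

theorem mul_inv_eq (h : IsSimDiag P Q W l) : P * Q⁻¹ = W * diagonal l * W⁻¹ := by
  rw [h.inv_eq, h.left_eq]
  calc _ = W * diagonal l * (Wᵀ * (W⁻¹)ᵀ) * W⁻¹ := by simp only [mul_assoc]
    _ = _ := by rw [h.transpose_mul_inv, mul_one]

theorem aeval_eq (h : IsSimDiag P Q W l) (q : Polynomial ℝ) :
    Polynomial.aeval (P * Q⁻¹) q = W * diagonal (fun i => q.eval (l i)) * W⁻¹ := by
  rw [h.mul_inv_eq]
  induction q using Polynomial.induction_on' with
  | add p q hp hq =>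
    rw [map_add, hp, hq, ← add_mul, ← mul_add, diagonal_add]
    simp
  | monomial k a =>
    have hk : ∀ k : ℕ, (W * diagonal l * W⁻¹) ^ k = W * diagonal l ^ k * W⁻¹ := fun k => by
      induction k with
      | zero => simp [h.mul_inv_cancel]
      | succ k ih =>
        rw [pow_succ, ih, pow_succ]
        calc _ = W * diagonal l ^ k * (W⁻¹ * W) * diagonal l * W⁻¹ := by simp only [mul_assoc]
          _ = _ := by rw [h.inv_mul_cancel, mul_one]; simp only [mul_assoc]
    rw [Polynomial.aeval_monomial, hk, diagonal_pow, Algebra.algebraMap_eq_smul_one, smul_one_mul,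
      ← smul_mul_assoc, ← mul_smul_comm, ← diagonal_smul]
    congr 3
    ext i
    simp

/-- Spectral sums become traces of polynomials in `P Q⁻¹`, which can be differentiated in time
without choosing eigenvalues smoothly. -/
theorem trace_aeval (h : IsSimDiag P Q W l) (q : Polynomial ℝ) :
    (Polynomial.aeval (P * Q⁻¹) q).trace = ∑ i, q.eval (l i) := by
  rw [h.aeval_eq, trace_mul_comm, ← mul_assoc, h.inv_mul_cancel, one_mul, trace_diagonal]

theorem trace_diagonal_mul (d : Fin n → ℝ) (M : Matrix (Fin n) (Fin n) ℝ) :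
    (diagonal d * M).trace = ∑ i, d i * M i i := by
  simp [trace, diagonal_mul]

theorem trace_aeval_mul_inv (h : IsSimDiag P Q W l) (q : Polynomial ℝ)
    (N : Matrix (Fin n) (Fin n) ℝ) :
    (Polynomial.aeval (P * Q⁻¹) q * (N * Q⁻¹)).trace =
      ∑ i, q.eval (l i) * (W⁻¹ * N * (W⁻¹)ᵀ) i i := by
  rw [← trace_diagonal_mul, h.aeval_eq, h.inv_eq]
  calc _ = ((W * diagonal (fun i => q.eval (l i)) * (W⁻¹ * N * (W⁻¹)ᵀ)) * W⁻¹).trace := by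
        simp only [mul_assoc]
    _ = ((W⁻¹ * W) * (diagonal (fun i => q.eval (l i)) * (W⁻¹ * N * (W⁻¹)ᵀ))).trace := by
        rw [trace_mul_comm]; simp only [mul_assoc]
    _ = _ := by rw [h.inv_mul_cancel, one_mul]

theorem trace_aeval_mul_left (h : IsSimDiag P Q W l) (q : Polynomial ℝ)
    (K : Matrix (Fin n) (Fin n) ℝ) :
    (Polynomial.aeval (P * Q⁻¹) q * (P * K)).trace =
      ∑ i, q.eval (l i) * (l i * (Wᵀ * K * W) i i) := by
  rw [h.aeval_eq]
  conv_lhs => rw [h.left_eq]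
  calc _ = (W * (diagonal (fun i => q.eval (l i)) * (W⁻¹ * W) * diagonal l * (Wᵀ * K))).trace := by
        simp only [mul_assoc]
    _ = (diagonal (fun i => q.eval (l i) * l i) * (Wᵀ * K * W)).trace := by
        rw [h.inv_mul_cancel, mul_one, diagonal_mul_diagonal, trace_mul_comm]
        simp only [mul_assoc]
    _ = _ := by rw [trace_diagonal_mul]; simp only [mul_assoc]

theorem natDist_eq (h : IsSimDiag P Q W l) : natDist P Q = √(∑ i, Real.log (l i) ^ 2) := by
  have : (P * Q⁻¹).charpoly.roots = Finset.univ.val.map l := by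
    rw [h.mul_inv_eq, charpoly_mul_comm, ← mul_assoc, h.inv_mul_cancel, one_mul, charpoly_diagonal,
      Polynomial.roots_prod _ _ (Finset.prod_ne_zero_iff.2 fun i _ => Polynomial.X_sub_C_ne_zero _)]
    simp
  rw [natDist, this, Multiset.map_map]
  rfl

/-- Rescaling the frame by `√l` normalizes `P` instead of `Q` and inverts the eigenvalues. -/
theorem symm (h : IsSimDiag P Q W l) :
    IsSimDiag Q P (W * diagonal fun i => √(l i)) fun i => (l i)⁻¹ := by
  refine ⟨h.isUnit.mul ?_, fun i => inv_pos.2 (h.pos i), ?_, ?_⟩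
  · rw [isUnit_diagonal, Pi.isUnit_iff]
    exact fun i => (Real.sqrt_pos.2 (h.pos i)).ne'.isUnit
  · rw [h.left_eq, transpose_mul, diagonal_transpose]
    calc _ = W * (diagonal (fun i => √(l i)) * diagonal (fun i => √(l i))) * Wᵀ := by
          rw [diagonal_mul_diagonal]
          congr 3
          ext i
          exact (Real.mul_self_sqrt (h.pos i).le).symm
      _ = _ := by simp only [mul_assoc]
  · rw [h.right_eq, transpose_mul, diagonal_transpose]
    calc W * Wᵀ = W * (diagonal (fun i => √(l i)) * diagonal (fun i => (l i)⁻¹) *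
          diagonal (fun i => √(l i))) * Wᵀ := by
          rw [diagonal_mul_diagonal, diagonal_mul_diagonal]
          have : (fun i => √(l i) * (l i)⁻¹ * √(l i)) = fun _ => 1 := by
            ext i
            have := h.pos i
            rw [mul_right_comm, Real.mul_self_sqrt this.le, _root_.mul_inv_cancel₀ this.ne']
          rw [this, diagonal_one, mul_one]
      _ = _ := by simp only [mul_assoc]

end IsSimDiag

theorem natDist_comm {P Q : Matrix (Fin n) (Fin n) ℝ} (hP : P.PosDef) (hQ : Q.PosDef) :
    natDist P Q = natDist Q P := by
  obtain ⟨W, l, h⟩ := exists_isSimDiag hP hQ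
  rw [h.natDist_eq, h.symm.natDist_eq]
  simp [Real.log_inv]

theorem natDist_nonneg (P Q : Matrix (Fin n) (Fin n) ℝ) : 0 ≤ natDist P Q := Real.sqrt_nonneg _

theorem natDist_self {Q : Matrix (Fin n) (Fin n) ℝ} (hQ : Q.PosDef) : natDist Q Q = 0 := by
  obtain ⟨B, hB, hQB⟩ := exists_eq_mul_transpose hQ
  have : IsSimDiag Q Q B fun _ => 1 := ⟨hB, fun _ => one_pos, hQB, by
    rw [diagonal_one, mul_one, ← hQB]⟩
  simp [this.natDist_eq]

theorem eq_of_natDist_eq_zero {P Q : Matrix (Fin n) (Fin n) ℝ} (hP : P.PosDef) (hQ : Q.PosDef)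
    (h0 : natDist P Q = 0) : P = Q := by
  obtain ⟨W, l, h⟩ := exists_isSimDiag hP hQ
  rw [h.natDist_eq, Real.sqrt_eq_zero (Finset.sum_nonneg fun i _ => sq_nonneg _),
    Finset.sum_eq_zero_iff_of_nonneg fun i _ => sq_nonneg _] at h0
  have : l = fun _ => 1 := by
    ext i
    exact Real.eq_one_of_pos_of_log_eq_zero (h.pos i) (by simpa using h0 i (Finset.mem_univ i))
  rw [h.left_eq, h.right_eq, this, diagonal_one, mul_one]

/-- A bound on the natural distance is a bound in the Loewner order. -/
theorem posSemidef_exp_smul_sub {P Q : Matrix (Fin n) (Fin n) ℝ} (hP : P.PosDef) (hQ : Q.PosDef)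
    {r : ℝ} (hr : natDist Q P ≤ r) : (Real.exp r • Q - P).PosSemidef := by
  obtain ⟨W, l, h⟩ := exists_isSimDiag hP hQ
  rw [natDist_comm hQ hP, h.natDist_eq] at hr
  have hd : (diagonal fun i => Real.exp r - l i).PosSemidef := PosSemidef.diagonal fun i => by
    -- One squared logarithm is at most their sum.
    have h1 : Real.log (l i) ≤ r := by
      refine le_trans ?_ hr
      refine Real.le_sqrt_of_sq_le ?_
      exact Finset.single_le_sum (f := fun i => Real.log (l i) ^ 2)
        (fun i _ => sq_nonneg _) (Finset.mem_univ i)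
    exact sub_nonneg.2 ((Real.log_le_iff_le_exp (h.pos i)).1 h1)
  have := posSemidef_conj hd Wᵀ
  convert this using 1
  rw [h.right_eq, h.left_eq, transpose_transpose, ← diagonal_sub, mul_sub, sub_mul]
  congr 1
  have : (diagonal fun _ : Fin n => Real.exp r) = Real.exp r • 1 := by
    ext i j; simp [Matrix.diagonal_apply, one_apply]
  rw [this]
  simp

/-! ### Scalar estimates for the logarithm. -/

theorem exists_derivative_eq (p : Polynomial ℝ) : ∃ q : Polynomial ℝ, Polynomial.derivative q = p := by
  induction p using Polynomial.induction_on' with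
  | add p q hp hq =>
    obtain ⟨P, rfl⟩ := hp
    obtain ⟨Q, rfl⟩ := hq
    exact ⟨P + Q, Polynomial.derivative_add⟩
  | monomial k a =>
    refine ⟨Polynomial.monomial (k + 1) (a / (k + 1)), ?_⟩
    rw [Polynomial.derivative_monomial, Nat.add_sub_cancel]
    congr 1
    push_cast
    field_simp

/-- Approximation of `log ^ 2` in the `C¹` sense by polynomials. -/
theorem exists_polynomial_near_log_sq {a b ε : ℝ} (ha : 0 < a) (ha1 : a ≤ 1) (hb1 : 1 ≤ b)
    (hε : 0 < ε) : ∃ q : Polynomial ℝ, ∀ x ∈ Icc a b,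
      |q.derivative.eval x - 2 * Real.log x / x| ≤ ε ∧ |q.eval x - Real.log x ^ 2| ≤ ε * b := by
  have hne : ∀ x ∈ Icc a b, x ≠ 0 := fun x hx => (ha.trans_le hx.1).ne'
  obtain ⟨p, hp⟩ := exists_polynomial_near_of_continuousOn a b (fun x => 2 * Real.log x / x)
    (ContinuousOn.div (continuousOn_const.mul (continuousOn_id.log hne)) continuousOn_id hne) ε hε
  obtain ⟨q₀, hq₀⟩ := exists_derivative_eq p
  have hd : ∀ x ∈ Icc a b, HasDerivWithinAt (fun x => (q₀ - Polynomial.C (q₀.eval 1)).eval x -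
      Real.log x ^ 2) (p.eval x - 2 * Real.log x / x) (Icc a b) x := fun x hx => by
    have h1 := (q₀ - Polynomial.C (q₀.eval 1)).hasDerivAt x
    have h2 := (Real.hasDerivAt_log (hne x hx)).pow 2
    refine ((h1.sub h2).congr_deriv ?_).hasDerivWithinAt
    simp only [Polynomial.derivative_sub, Polynomial.derivative_C, sub_zero, hq₀]
    push_cast
    field_simp
  -- A primitive of a Weierstrass approximant of the derivative, normalized to vanish at `1` as
  -- `log²` does. The mean value inequality from `1` then bounds the error in value.
  refine ⟨q₀ - Polynomial.C (q₀.eval 1), fun x hx => ⟨?_, ?_⟩⟩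
  · simpa [hq₀] using (hp x hx).le
  · have := (convex_Icc a b).norm_image_sub_le_of_norm_hasDerivWithin_le (C := ε) hd
      (fun y hy => (hp y hy).le) (⟨ha1, hb1⟩ : (1 : ℝ) ∈ Icc a b) hx
    simp only [Polynomial.eval_sub, Polynomial.eval_C, sub_self, Real.log_one, Real.norm_eq_abs,
      ne_eq, OfNat.ofNat_ne_zero, not_false_eq_true, zero_pow, sub_zero] at this
    simp only [Polynomial.eval_sub, Polynomial.eval_C]
    refine this.trans (mul_le_mul_of_nonneg_left ?_ hε.le)
    rw [abs_le]
    constructor <;> linarith [hx.1, hx.2]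

/-- The pointwise inequality behind the contraction of the natural distance. -/
theorem log_mul_le {c l w : ℝ} (hc : 0 ≤ c) (hl : 0 < l) (h1 : c ≤ w) (h2 : c * l ≤ w) :
    2 * Real.log l / l * (1 - l) * w ≤ -(2 * c) * Real.log l ^ 2 := by
  have hu : Real.log l ≤ l - 1 := Real.log_le_sub_one_of_pos hl
  have hv : -Real.log l ≤ 1 / l - 1 := by
    have := Real.log_le_sub_one_of_pos (inv_pos.2 hl)
    rwa [Real.log_inv, ← one_div] at this
  rcases le_total 1 l with h | h
  · have hlog : 0 ≤ Real.log l := Real.log_nonneg h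
    have e1 : c * Real.log l ^ 2 ≤ c * (Real.log l * (l - 1)) := by
      rw [sq]; gcongr
    have e2 : Real.log l / l * (l - 1) * (c * l) ≤ Real.log l / l * (l - 1) * w :=
      mul_le_mul_of_nonneg_left h2 (mul_nonneg (div_nonneg hlog hl.le) (by linarith))
    have e3 : Real.log l / l * (l - 1) * (c * l) = c * (Real.log l * (l - 1)) := by
      field_simp
    have e4 : 2 * Real.log l / l * (1 - l) * w = -2 * (Real.log l / l * (l - 1) * w) := by ring
    rw [e4]; nlinarith
  · have hlog : 0 ≤ -Real.log l := by linarith [Real.log_nonpos hl.le h]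
    have e1 : c * (-Real.log l) ^ 2 ≤ c * (-Real.log l * (1 / l - 1)) := by
      rw [sq]; gcongr
    have e2 : -Real.log l * (1 / l - 1) * c ≤ -Real.log l * (1 / l - 1) * w :=
      mul_le_mul_of_nonneg_left h1 (mul_nonneg hlog (by linarith))
    have e4 : 2 * Real.log l / l * (1 - l) * w = -2 * (-Real.log l * (1 / l - 1) * w) := by
      field_simp
    rw [e4]; nlinarith

/-! ### Derivatives of spectral traces along two solutions. -/

section Calculus

open scoped Matrix.Norms.Operator

theorem hasDerivWithinAt_trace_aeval {T : ℝ → Matrix (Fin n) (Fin n) ℝ}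
    {T' : Matrix (Fin n) (Fin n) ℝ} {J : Set ℝ} {t : ℝ} (h : HasDerivWithinAt T T' J t)
    (q : Polynomial ℝ) :
    HasDerivWithinAt (fun s => (Polynomial.aeval (T s) q).trace)
      (Polynomial.aeval (T t) (Polynomial.derivative q) * T').trace J t := by
  -- `T` and its derivative need not commute, so the derivative of `q(T)` is not `q'(T) T'`.
  -- Cyclicity of the trace makes them agree when tested against any polynomial `r` in `T`, and
  -- carrying `r` along makes the induction close.
  have key : ∃ D, HasDerivWithinAt (fun s => Polynomial.aeval (T s) q) D J t ∧
      ∀ r : Polynomial ℝ, (Polynomial.aeval (T t) r * D).trace =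
        (Polynomial.aeval (T t) (r * Polynomial.derivative q) * T').trace := by
    induction q using Polynomial.induction_on with
    | C a => exact ⟨0, by
        simp only [Polynomial.aeval_C]
        exact hasDerivWithinAt_const t J _, by simp⟩
    | add p q hp hq =>
      obtain ⟨D, hD, hr⟩ := hp
      obtain ⟨E, hE, hs⟩ := hq
      refine ⟨D + E, by simp only [map_add]; exact hD.add hE, fun r => ?_⟩
      simp [mul_add, add_mul, hr, hs]
    | monomial k a ih =>
      obtain ⟨D, hD, hr⟩ := ih
      have e : Polynomial.C a * Polynomial.X ^ (k + 1) =
        Polynomial.C a * Polynomial.X ^ k * Polynomial.X := by rw [pow_succ, mul_assoc]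
      refine ⟨D * T t + Polynomial.aeval (T t) (Polynomial.C a * Polynomial.X ^ k) * T', ?_,
        fun r => ?_⟩
      · rw [e]
        simp only [map_mul _ _ Polynomial.X, Polynomial.aeval_X]
        exact hD.mul h
      · rw [e, mul_add, trace_add, ← mul_assoc, trace_mul_comm, ← mul_assoc]
        have e2 : T t * Polynomial.aeval (T t) r = Polynomial.aeval (T t) (Polynomial.X * r) := by
          simp
        rw [e2, hr, ← mul_assoc, ← map_mul, ← trace_add, ← add_mul, ← map_add]
        congr 3
        rw [Polynomial.derivative_mul (g := Polynomial.X), Polynomial.derivative_X]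
        ring
  obtain ⟨D, hD, hr⟩ := key
  have := hr 1
  rw [map_one, one_mul, one_mul] at this
  rw [← this]
  exact hasDerivWithinAt_trace hD

/-- The derivative of the quotient `P₁ P₂⁻¹` of two solutions of the Riccati equation. -/
theorem hasDerivWithinAt_mul_inv {A N K : Matrix (Fin n) (Fin n) ℝ}
    {P₁ P₂ : ℝ → Matrix (Fin n) (Fin n) ℝ} {J : Set ℝ} {t : ℝ}
    (h₁ : HasDerivWithinAt P₁ (A * P₁ t + P₁ t * Aᵀ + N - P₁ t * K * P₁ t) J t)
    (h₂ : HasDerivWithinAt P₂ (A * P₂ t + P₂ t * Aᵀ + N - P₂ t * K * P₂ t) J t)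
    (hu : IsUnit (P₂ t)) :
    HasDerivWithinAt (fun s => P₁ s * (P₂ s)⁻¹)
      (A * (P₁ t * (P₂ t)⁻¹) - (P₁ t * (P₂ t)⁻¹) * A + (1 - P₁ t * (P₂ t)⁻¹) * (N * (P₂ t)⁻¹) +
        (P₁ t * K) * (1 - P₁ t * (P₂ t)⁻¹)) J t := by
  refine (h₁.mul (hasDerivWithinAt_inv h₂ hu)).congr_deriv ?_
  have hi : P₂ t * (P₂ t)⁻¹ = 1 := mul_nonsing_inv _ ((isUnit_iff_isUnit_det _).1 hu)
  have hj : (P₂ t)⁻¹ * P₂ t = 1 := nonsing_inv_mul _ ((isUnit_iff_isUnit_det _).1 hu)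
  generalize P₁ t = P at *
  generalize P₂ t = Q at *
  have e : Q⁻¹ * (A * Q + Q * Aᵀ + N - Q * K * Q) * Q⁻¹ =
      Q⁻¹ * A * (Q * Q⁻¹) + (Q⁻¹ * Q) * Aᵀ * Q⁻¹ + Q⁻¹ * N * Q⁻¹ -
      (Q⁻¹ * Q) * K * (Q * Q⁻¹) := by noncomm_ring
  rw [e, hi, hj]
  noncomm_ring

/-- The commutator with `A` is traceless against anything commuting with `P Q⁻¹`, so the drift
disappears. Only the noise and observation terms remain, diagonal in the frame `W`. -/
theorem IsSimDiag.trace_aeval_mul {A N K P Q W : Matrix (Fin n) (Fin n) ℝ} {l : Fin n → ℝ}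
    (h : IsSimDiag P Q W l) (q : Polynomial ℝ) :
    (Polynomial.aeval (P * Q⁻¹) q * (A * (P * Q⁻¹) - (P * Q⁻¹) * A +
      (1 - P * Q⁻¹) * (N * Q⁻¹) + (P * K) * (1 - P * Q⁻¹))).trace =
    ∑ i, q.eval (l i) * (1 - l i) *
      ((W⁻¹ * N * (W⁻¹)ᵀ) i i + l i * (Wᵀ * K * W) i i) := by
  have e1 : (Polynomial.aeval (P * Q⁻¹) q * (A * (P * Q⁻¹) - (P * Q⁻¹) * A)).trace = 0 := by
    rw [mul_sub, trace_sub, sub_eq_zero]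
    have c : Polynomial.aeval (P * Q⁻¹) q * (P * Q⁻¹) =
        (P * Q⁻¹) * Polynomial.aeval (P * Q⁻¹) q := by
      have := congrArg (Polynomial.aeval (P * Q⁻¹)) (mul_comm q Polynomial.X)
      simpa only [map_mul, Polynomial.aeval_X] using this
    rw [← mul_assoc, trace_mul_comm, ← mul_assoc, ← c, mul_assoc]
  have e2 : Polynomial.aeval (P * Q⁻¹) q * (1 - P * Q⁻¹) =
      Polynomial.aeval (P * Q⁻¹) (q * (1 - Polynomial.X)) := by
    simp only [map_mul, map_sub, map_one, Polynomial.aeval_X]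
  have e3 : (1 - P * Q⁻¹) * Polynomial.aeval (P * Q⁻¹) q =
      Polynomial.aeval (P * Q⁻¹) (q * (1 - Polynomial.X)) := by
    rw [mul_comm q]
    simp only [map_mul, map_sub, map_one, Polynomial.aeval_X]
  have e4 : (Polynomial.aeval (P * Q⁻¹) q * ((P * K) * (1 - P * Q⁻¹))).trace =
      (Polynomial.aeval (P * Q⁻¹) (q * (1 - Polynomial.X)) * (P * K)).trace := by
    rw [← mul_assoc, trace_mul_comm, ← mul_assoc, e3]
  rw [mul_add, mul_add, trace_add, trace_add, e1, e4, ← mul_assoc, e2, zero_add,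
    h.trace_aeval_mul_inv, h.trace_aeval_mul_left, ← Finset.sum_add_distrib]
  refine Finset.sum_congr rfl fun i _ => ?_
  simp
  ring

/-- The weights in the derivative of the distance dominate `c * max 1 l`. -/
theorem IsSimDiag.le_weight {N K P Q W : Matrix (Fin n) (Fin n) ℝ} {l : Fin n → ℝ}
    (h : IsSimDiag P Q W l) (hK : K.PosSemidef) {c : ℝ}
    (hP : (N - c • P).PosSemidef) (hQ : (N - c • Q).PosSemidef) (i : Fin n) :
    c ≤ (W⁻¹ * N * (W⁻¹)ᵀ) i i + l i * (Wᵀ * K * W) i i ∧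
      c * l i ≤ (W⁻¹ * N * (W⁻¹)ᵀ) i i + l i * (Wᵀ * K * W) i i := by
  have hκ : 0 ≤ l i * (Wᵀ * K * W) i i := mul_nonneg (h.pos i).le (posSemidef_conj hK W).diag_nonneg
  have h1 := (posSemidef_conj hQ (W⁻¹)ᵀ).diag_nonneg (i := i)
  have h2 := (posSemidef_conj hP (W⁻¹)ᵀ).diag_nonneg (i := i)
  -- In the frame `W` the bound `N ≥ cQ` has diagonal entries `≥ c`, and `N ≥ cP` has diagonal
  -- entries `≥ c * l i`.
  have e1 : W⁻¹ * Q * (W⁻¹)ᵀ = 1 := by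
    rw [h.right_eq]
    calc _ = (W⁻¹ * W) * (Wᵀ * (W⁻¹)ᵀ) := by simp only [mul_assoc]
      _ = _ := by rw [h.inv_mul_cancel, h.transpose_mul_inv, one_mul]
  have e2 : W⁻¹ * P * (W⁻¹)ᵀ = diagonal l := by
    rw [h.left_eq]
    calc _ = (W⁻¹ * W) * diagonal l * (Wᵀ * (W⁻¹)ᵀ) := by simp only [mul_assoc]
      _ = _ := by rw [h.inv_mul_cancel, h.transpose_mul_inv, one_mul, mul_one]
  rw [transpose_transpose, mul_sub, sub_mul, mul_smul_comm, smul_mul_assoc, e1] at h1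
  rw [transpose_transpose, mul_sub, sub_mul, mul_smul_comm, smul_mul_assoc, e2] at h2
  simp only [Matrix.sub_apply, Matrix.smul_apply, one_apply_eq, diagonal_apply_eq, smul_eq_mul] at h1 h2
  constructor <;> linarith

/-- The right side does not involve `W`. It is therefore continuous in time along solutions, and the
total weight is bounded on a compact interval. -/
theorem IsSimDiag.sum_weight {N K P Q W : Matrix (Fin n) (Fin n) ℝ} {l : Fin n → ℝ}
    (h : IsSimDiag P Q W l) :
    ∑ i, ((W⁻¹ * N * (W⁻¹)ᵀ) i i + l i * (Wᵀ * K * W) i i) =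
      (N * Q⁻¹).trace + (P * K).trace := by
  have h1 := h.trace_aeval_mul_inv 1 N
  have h2 := h.trace_aeval_mul_left 1 K
  simp only [map_one, one_mul, Polynomial.eval_one] at h1 h2
  rw [h1, h2, Finset.sum_add_distrib]

theorem IsSimDiag.trace_eq {P Q W : Matrix (Fin n) (Fin n) ℝ} {l : Fin n → ℝ}
    (h : IsSimDiag P Q W l) : (P * Q⁻¹).trace = ∑ i, l i := by
  simpa using h.trace_aeval Polynomial.X

/-- Comparison of an approximate decay inequality. -/
theorem le_of_deriv_le_neg_mul_add {E E' : ℝ → ℝ} {b k δ : ℝ} (hb : 0 ≤ b) (hk : 0 ≤ k)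
    (hδ : 0 ≤ δ) (hE : ∀ t ∈ Icc 0 b, HasDerivWithinAt E (E' t) (Icc 0 b) t)
    (hle : ∀ t ∈ Icc 0 b, E' t ≤ -k * E t + δ) :
    Real.exp (k * b) * E b ≤ E 0 + δ * Real.exp (k * b) * b := by
  -- Integrating factor `exp (k * t)`. The error is subtracted at the larger constant rate `δ * exp
  -- (k * b)`, which keeps its integral linear.
  have hd : ∀ t ∈ Icc 0 b, HasDerivWithinAt
      (fun t => Real.exp (k * t) * E t - δ * Real.exp (k * b) * t)
      (Real.exp (k * t) * (k * E t + E' t) - δ * Real.exp (k * b)) (Icc 0 b) t := fun t ht => by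
    have h1 : HasDerivAt (fun t : ℝ => Real.exp (k * t)) (Real.exp (k * t) * (k * 1)) t :=
      ((hasDerivAt_id t).const_mul k).exp
    have h2 : HasDerivAt (fun t : ℝ => δ * Real.exp (k * b) * t) (δ * Real.exp (k * b) * 1) t :=
      (hasDerivAt_id t).const_mul _
    refine ((h1.hasDerivWithinAt.mul (hE t ht)).sub h2.hasDerivWithinAt).congr_deriv ?_
    ring
  have hanti : AntitoneOn (fun t => Real.exp (k * t) * E t - δ * Real.exp (k * b) * t)
      (Icc 0 b) := by
    refine antitoneOn_of_hasDerivWithinAt_nonpos (convex_Icc 0 b)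
      (fun t ht => (hd t ht).continuousWithinAt)
      (fun t ht => (hd t (interior_subset ht)).mono interior_subset) fun t ht => ?_
    have ht' := interior_subset ht
    have h1 : Real.exp (k * t) ≤ Real.exp (k * b) :=
      Real.exp_le_exp.2 (mul_le_mul_of_nonneg_left ht'.2 hk)
    have h2 : Real.exp (k * t) * (k * E t + E' t) ≤ Real.exp (k * t) * δ :=
      mul_le_mul_of_nonneg_left (by linarith [hle t ht']) (Real.exp_pos _).le
    nlinarith
  have := hanti (left_mem_Icc.2 hb) (right_mem_Icc.2 hb) hb
  simp at this
  linarith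

end Calculus

/-! ### The contraction estimate. -/

section Calculus

open scoped Matrix.Norms.Operator

theorem natDist_sq {P Q W : Matrix (Fin n) (Fin n) ℝ} {l : Fin n → ℝ} (h : IsSimDiag P Q W l) :
    natDist P Q ^ 2 = ∑ i, Real.log (l i) ^ 2 := by
  rw [h.natDist_eq, Real.sq_sqrt (Finset.sum_nonneg fun i _ => sq_nonneg _)]

/-- All eigenvalues are positive, so each is at most the trace; applied to `P Q⁻¹` and to `Q P⁻¹`,
this bounds them above and away from zero. -/
theorem IsSimDiag.mem_Icc {P Q W : Matrix (Fin n) (Fin n) ℝ} {l : Fin n → ℝ}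
    (h : IsSimDiag P Q W l) {β : ℝ} (h1 : (P * Q⁻¹).trace ≤ β)
    (h2 : (Q * P⁻¹).trace ≤ β) (i : Fin n) : l i ∈ Icc β⁻¹ β := by
  have e1 : l i ≤ β := by
    refine le_trans ?_ h1
    rw [h.trace_eq]
    exact Finset.single_le_sum (f := l) (fun i _ => (h.pos i).le) (Finset.mem_univ i)
  have e2 : (l i)⁻¹ ≤ β := by
    refine le_trans ?_ h2
    rw [h.symm.trace_eq]
    exact Finset.single_le_sum (f := fun i => (l i)⁻¹) (fun i _ => (inv_pos.2 (h.pos i)).le)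
      (Finset.mem_univ i)
  exact ⟨inv_le_of_inv_le₀ (h.pos i) e2, e1⟩

theorem le_of_forall_pos_le_add_mul {x y C : ℝ} (hC : 0 ≤ C)
    (h : ∀ ε > 0, x ≤ y + ε * C) : x ≤ y := by
  refine le_of_forall_pos_le_add fun η hη => (h (η / (C + 1)) (by positivity)).trans ?_
  have : η / (C + 1) * C ≤ η := by
    rw [div_mul_eq_mul_div, div_le_iff₀ (by positivity)]
    nlinarith
  linarith

/-- The Riccati flow contracts the natural distance at rate `c` as long as `c P ≤ N`. -/
theorem natDist_le_exp_mul {A N K : Matrix (Fin n) (Fin n) ℝ} (hK : K.PosSemidef) {c b : ℝ}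
    (hc : 0 ≤ c) (hb : 0 ≤ b) {P₁ P₂ : ℝ → Matrix (Fin n) (Fin n) ℝ}
    (h₁ : ∀ t ∈ Icc 0 b,
      HasDerivWithinAt P₁ (A * P₁ t + P₁ t * Aᵀ + N - P₁ t * K * P₁ t) (Icc 0 b) t)
    (h₂ : ∀ t ∈ Icc 0 b,
      HasDerivWithinAt P₂ (A * P₂ t + P₂ t * Aᵀ + N - P₂ t * K * P₂ t) (Icc 0 b) t)
    (p₁ : ∀ t ∈ Icc 0 b, (P₁ t).PosDef) (p₂ : ∀ t ∈ Icc 0 b, (P₂ t).PosDef)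
    (b₁ : ∀ t ∈ Icc 0 b, (N - c • P₁ t).PosSemidef)
    (b₂ : ∀ t ∈ Icc 0 b, (N - c • P₂ t).PosSemidef) :
    natDist (P₁ b) (P₂ b) ≤ Real.exp (-c * b) * natDist (P₁ 0) (P₂ 0) := by
  have hc₁ : ContinuousOn P₁ (Icc 0 b) := fun s hs => (h₁ s hs).continuousWithinAt
  have hi₁ : ContinuousOn (fun s => (P₁ s)⁻¹) (Icc 0 b) := fun s hs =>
    (hasDerivWithinAt_inv (h₁ s hs) (p₁ s hs).isUnit).continuousWithinAt
  have hc₂ : ContinuousOn P₂ (Icc 0 b) := fun s hs => (h₂ s hs).continuousWithinAt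
  have hi₂ : ContinuousOn (fun s => (P₂ s)⁻¹) (Icc 0 b) := fun s hs =>
    (hasDerivWithinAt_inv (h₂ s hs) (p₂ s hs).isUnit).continuousWithinAt
  have htr : Continuous fun M : Matrix (Fin n) (Fin n) ℝ => M.trace :=
    continuous_id.matrix_trace
  obtain ⟨β₁, hβ₁⟩ := isCompact_Icc.exists_bound_of_continuousOn
    (htr.comp_continuousOn (hc₁.mul hi₂))
  obtain ⟨β₂, hβ₂⟩ := isCompact_Icc.exists_bound_of_continuousOn
    (htr.comp_continuousOn (hc₂.mul hi₁))
  obtain ⟨S, hS⟩ := isCompact_Icc.exists_bound_of_continuousOn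
    ((htr.comp_continuousOn (continuousOn_const (c := N).mul hi₂)).add
      (htr.comp_continuousOn (hc₁.mul (continuousOn_const (c := K)))))
  have h0 : (0 : ℝ) ∈ Icc 0 b := left_mem_Icc.2 hb
  have hS0 : 0 ≤ S := (norm_nonneg _).trans (hS 0 h0)
  -- Including `1` puts the base point of the approximation of `log²` inside `[β⁻¹, β]`.
  set β := max 1 (max β₁ β₂) with hβdef
  have hβ1 : 1 ≤ β := le_max_left _ _
  have hβ0 : 0 < β := one_pos.trans_le hβ1
  have hmem : ∀ t ∈ Icc 0 b, ∀ W l, IsSimDiag (P₁ t) (P₂ t) W l → ∀ i, l i ∈ Icc β⁻¹ β :=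
    fun t ht W l h i => h.mem_Icc
      ((le_abs_self _).trans ((hβ₁ t ht).trans ((le_max_left _ _).trans (le_max_right _ _))))
      ((le_abs_self _).trans ((hβ₂ t ht).trans ((le_max_right _ _).trans (le_max_right _ _)))) i
  have hsq : Real.exp (2 * c * b) * natDist (P₁ b) (P₂ b) ^ 2 ≤ natDist (P₁ 0) (P₂ 0) ^ 2 := by
    -- The three terms of `C` are the approximation errors at times `b` and `0` and the integrated
    -- error of the differential inequality.
    refine le_of_forall_pos_le_add_mul (C := Real.exp (2 * c * b) * (n * β) + n * β +
      (β * S + 2 * c * (n * β)) * Real.exp (2 * c * b) * b) (by positivity) fun ε hε => ?_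
    obtain ⟨q, hq⟩ := exists_polynomial_near_log_sq (a := β⁻¹) (b := β) (inv_pos.2 hβ0)
      (inv_le_one_of_one_le₀ hβ1) hβ1 hε
    have happ : ∀ t ∈ Icc 0 b, |(Polynomial.aeval (P₁ t * (P₂ t)⁻¹) q).trace -
        natDist (P₁ t) (P₂ t) ^ 2| ≤ n * (ε * β) := fun t ht => by
      obtain ⟨W, l, h⟩ := exists_isSimDiag (p₁ t ht) (p₂ t ht)
      rw [h.trace_aeval, natDist_sq h, ← Finset.sum_sub_distrib]
      refine (Finset.abs_sum_le_sum_abs _ _).trans ?_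
      refine (Finset.sum_le_sum fun i _ => (hq _ (hmem t ht W l h i)).2).trans ?_
      simp
    have hgr := le_of_deriv_le_neg_mul_add (b := b) (k := 2 * c)
      (δ := ε * (β * S + 2 * c * (n * β)))
      hb (by positivity) (by positivity)
      (fun t ht => hasDerivWithinAt_trace_aeval
        (hasDerivWithinAt_mul_inv (h₁ t ht) (h₂ t ht) (p₂ t ht).isUnit) q) fun t ht => by
      obtain ⟨W, l, h⟩ := exists_isSimDiag (p₁ t ht) (p₂ t ht)
      rw [h.trace_aeval_mul]
      have hw := h.le_weight hK (b₁ t ht) (b₂ t ht)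
      have hsum := h.sum_weight (N := N) (K := K)
      have hSt : (N * (P₂ t)⁻¹).trace + (P₁ t * K).trace ≤ S := (le_abs_self _).trans (hS t ht)
      rw [← hsum] at hSt
      -- The frame `W` is chosen afresh at each time, with no regularity in `t`.
      set w : Fin n → ℝ := fun i => (W⁻¹ * N * (W⁻¹)ᵀ) i i + l i * (Wᵀ * K * W) i i
      have hterm : ∀ i, q.derivative.eval (l i) * (1 - l i) * w i ≤
          -(2 * c) * Real.log (l i) ^ 2 + ε * β * w i := fun i => by
        have hl := hmem t ht W l h i
        have hw0 : 0 ≤ w i := hc.trans (hw i).1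
        have e1 := log_mul_le hc (h.pos i) (hw i).1 (hw i).2
        have e2 : (q.derivative.eval (l i) - 2 * Real.log (l i) / l i) * (1 - l i) ≤ ε * β := by
          refine (le_abs_self _).trans ?_
          rw [abs_mul]
          refine mul_le_mul (hq _ hl).1 ?_ (abs_nonneg _) hε.le
          rw [abs_le]
          constructor <;> linarith [h.pos i, hl.2]
        have e3 := mul_le_mul_of_nonneg_right e2 hw0
        calc _ = 2 * Real.log (l i) / l i * (1 - l i) * w i +
              (q.derivative.eval (l i) - 2 * Real.log (l i) / l i) * (1 - l i) * w i := by ring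
          _ ≤ _ := add_le_add e1 e3
      refine (Finset.sum_le_sum fun i _ => hterm i).trans ?_
      rw [Finset.sum_add_distrib, ← Finset.mul_sum, ← Finset.mul_sum, ← natDist_sq h]
      have e4 := mul_le_mul_of_nonneg_left hSt (by positivity : 0 ≤ ε * β)
      have e5 := mul_le_mul_of_nonneg_left ((le_abs_self _).trans (happ t ht))
        (by positivity : 0 ≤ 2 * c)
      change ε * β * ∑ i, w i ≤ _ at e4
      linarith
    have a1 := mul_le_mul_of_nonneg_left ((neg_le_abs _).trans (happ b (right_mem_Icc.2 hb)))
      (Real.exp_pos (2 * c * b)).le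
    have a2 := (le_abs_self _).trans (happ 0 h0)
    linarith
  have hexp : Real.exp (2 * c * b) = Real.exp (c * b) ^ 2 := by
    rw [sq, ← Real.exp_add]; ring_nf
  rw [hexp, ← mul_pow] at hsq
  have := (pow_le_pow_iff_left₀ (mul_nonneg (Real.exp_pos _).le (natDist_nonneg _ _))
    (natDist_nonneg _ _) two_ne_zero).1 hsq
  rw [neg_mul, Real.exp_neg, ← div_eq_inv_mul, le_div_iff₀ (Real.exp_pos _), mul_comm]
  exact this

end Calculus

/-! ### Rank conditions, observability and a supersolution. -/

theorem eq_zero_of_rank_eq {ι : Type*} [Fintype ι] {M : Matrix ι (Fin n) ℝ} (hM : M.rank = n)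
    {x : Fin n → ℝ} (hx : M *ᵥ x = 0) : x = 0 := by
  have h := LinearMap.finrank_range_add_finrank_ker M.mulVecLin
  rw [← Matrix.rank, hM, Module.finrank_fin_fun] at h
  have hk : M.mulVecLin.ker = ⊥ := Submodule.finrank_eq_zero.1 (by omega)
  exact (LinearMap.ker_eq_bot'.1 hk) x hx

theorem posDef_mul_transpose_of_rank {G : Matrix (Fin n) (Fin m) ℝ} (hG : G.rank = n) :
    (G * Gᵀ).PosDef := by
  refine posDef_iff.2 ⟨by simp, fun x hx => ?_⟩
  have e : x ⬝ᵥ ((G * Gᵀ) *ᵥ x) = (Gᵀ *ᵥ x) ⬝ᵥ (Gᵀ *ᵥ x) := by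
    rw [← mulVec_mulVec, dotProduct_mulVec, ← mulVec_transpose]
  rw [e]
  refine lt_of_le_of_ne (Finset.sum_nonneg fun i _ => mul_self_nonneg _) fun h => hx ?_
  exact eq_zero_of_rank_eq (by rw [rank_transpose, hG]) (dotProduct_self_eq_zero.1 h.symm)

theorem posDef_mul_transpose_of_isUnit {H : Matrix (Fin p) (Fin p) ℝ} (hH : IsUnit (H * Hᵀ)) :
    (H * Hᵀ).PosDef := by
  have : (H * Hᵀ).PosSemidef := by
    simpa [conjTranspose_eq_transpose_of_trivial] using posSemidef_self_mul_conjTranspose H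
  exact this.posDef_iff_isUnit.2 hH

theorem eq_zero_of_isObservable {A : Matrix (Fin n) (Fin n) ℝ} {C : Matrix (Fin p) (Fin n) ℝ}
    (h : IsObservable A C) {x : Fin n → ℝ} (hx : ∀ k : ℕ, C *ᵥ (A ^ k *ᵥ x) = 0) : x = 0 := by
  refine eq_zero_of_rank_eq h ?_
  ext ⟨k, i⟩
  have := congrFun (hx k) i
  rw [mulVec_mulVec] at this
  exact this

section Information

variable {C : Matrix (Fin p) (Fin n) ℝ} {R : Matrix (Fin p) (Fin p) ℝ}

theorem dotProduct_information (x : Fin n → ℝ) :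
    x ⬝ᵥ ((Cᵀ * R * C) *ᵥ x) = (C *ᵥ x) ⬝ᵥ (R *ᵥ (C *ᵥ x)) := by
  rw [← mulVec_mulVec, ← mulVec_mulVec, dotProduct_mulVec, vecMul_transpose]

theorem posSemidef_information (hR : R.PosDef) : (Cᵀ * R * C).PosSemidef := by
  simpa [conjTranspose_eq_transpose_of_trivial] using hR.posSemidef.conjTranspose_mul_mul_same C

end Information

section Calculus

open scoped Matrix.Norms.Operator

theorem hasDerivAt_mulVec {P : ℝ → Matrix (Fin n) (Fin n) ℝ}
    {P' : Matrix (Fin n) (Fin n) ℝ} {t : ℝ} (h : HasDerivAt P P' t) (M : Matrix (Fin p) (Fin n) ℝ)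
    (x : Fin n → ℝ) : HasDerivAt (fun s => M *ᵥ (P s *ᵥ x)) (M *ᵥ (P' *ᵥ x)) t :=
  hasDerivWithinAt_univ.1 <| hasDerivWithinAt_linear
    { toFun := fun N : Matrix (Fin n) (Fin n) ℝ => M *ᵥ (N *ᵥ x)
      map_add' := fun N N' => by rw [add_mulVec, mulVec_add]
      map_smul' := fun c N => by simp [smul_mulVec, mulVec_smul] } (hasDerivWithinAt_univ.2 h)

theorem eq_zero_of_hasDerivAt_of_eq_const {E : Type*} [NormedAddCommGroup E] [NormedSpace ℝ E]
    {f : ℝ → E} {f' c : E} {s : Set ℝ} (hs : UniqueDiffOn ℝ s) {t : ℝ} (ht : t ∈ s)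
    (h : HasDerivWithinAt f f' s t) (hf : ∀ x ∈ s, f x = c) : f' = 0 :=
  (hs t ht).eq_deriv s h ((hasDerivWithinAt_const t s c).congr hf (hf t ht))

/-- An observable pair has a strict quadratic Lyapunov certificate modulo the output. -/
theorem exists_observability_certificate {A : Matrix (Fin n) (Fin n) ℝ}
    {C : Matrix (Fin p) (Fin n) ℝ} {R : Matrix (Fin p) (Fin p) ℝ} (h : IsObservable A C)
    (hR : R.PosDef) : ∃ Z : Matrix (Fin n) (Fin n) ℝ, Z.PosDef ∧
      (Cᵀ * R * C - Aᵀ * Z - Z * A - Z).PosSemidef := by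
  set K := Cᵀ * R * C with hKdef
  have hK : K.PosSemidef := posSemidef_information hR
  have hKs := (posSemidef_iff.1 hK).1
  -- With zero quadratic term and drift `-(Aᵀ + 1/2)`, `X` is the flow of `A + 1/2` and `XᵀY` is the
  -- Gramian `∫ XᵀKX`. The shift by `1/2` produces the extra `-Z` in the certificate.
  obtain ⟨X, Y, hXY, hX, hY⟩ :=
    exists_isHamiltonianFlow (-(Aᵀ + (1 / 2 : ℝ) • 1)) K 0 (1 : Matrix (Fin n) (Fin n) ℝ) 0
  have hmono := hXY.monotone_form hK PosSemidef.zero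
  have hdX : ∀ t, HasDerivAt X (A * X t + (1 / 2 : ℝ) • X t) t := fun t =>
    (hXY.deriv_fst t).congr_deriv (by simp [add_mul])
  have hpd : ((X 1)ᵀ * Y 1).PosDef := by
    refine posDef_iff.2 ⟨?_, fun x hx => ?_⟩
    · rw [transpose_mul, transpose_transpose, hXY.transpose_mul_comm hKs (by simp) (by simp [hY])]
    · have hz : x ⬝ᵥ (((X 0)ᵀ * Y 0) *ᵥ x) = 0 := by simp [hY]
      refine lt_of_le_of_ne (by simpa only [hz] using hmono x zero_le_one) fun h1 => hx ?_
      -- If the Gramian vanishes on `x` at time one, monotonicity makes the form constant on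
      -- `[0,1]`. Its derivative then gives `C X x = 0`, and repeated differentiation brings out the
      -- powers of `A`.
      have hc : ∀ s ∈ Icc (0 : ℝ) 1, x ⬝ᵥ (((X s)ᵀ * Y s) *ᵥ x) = 0 := fun s hs =>
        le_antisymm ((hmono x hs.2).trans h1.symm.le) (hz.symm.le.trans (hmono x hs.1))
      have hu := uniqueDiffOn_Icc (zero_lt_one' ℝ)
      have hk : ∀ k : ℕ, ∀ s ∈ Icc (0 : ℝ) 1, (C * A ^ k) *ᵥ (X s *ᵥ x) = 0 := fun k => by
        induction k with
        | zero =>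
          intro s hs
          have := eq_zero_of_hasDerivAt_of_eq_const hu hs
            (hXY.hasDerivAt_form (by simp) x s).hasDerivWithinAt hc
          rw [zero_mulVec, dotProduct_zero, zero_add, hKdef, dotProduct_information] at this
          rw [pow_zero, Matrix.mul_one]
          by_contra hne
          exact ((posDef_iff.1 hR).2 _ hne).ne' this
        | succ k ih =>
          intro s hs
          have := eq_zero_of_hasDerivAt_of_eq_const hu hs
            (hasDerivAt_mulVec (hdX s) (C * A ^ k) x).hasDerivWithinAt ih
          rw [add_mulVec, mulVec_add, smul_mulVec, mulVec_smul, ih s hs, smul_zero, add_zero] at this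
          rw [pow_succ, ← Matrix.mul_assoc, ← mulVec_mulVec, mulVec_mulVec x A (X s)]
          exact this
      refine eq_zero_of_isObservable h fun k => ?_
      have := hk k 0 (left_mem_Icc.2 zero_le_one)
      rwa [hX, one_mulVec, ← mulVec_mulVec] at this
  have hu := IsHamiltonianFlow.isUnit_fst hpd
  refine ⟨Y 1 * (X 1)⁻¹, IsHamiltonianFlow.posDef_quotient hpd, ?_⟩
  -- Here the congruence identity reads `K - AᵀZ - ZA - Z = X⁻ᵀ K X⁻¹`.
  have hq := hXY.quotient_riccati hKs (by simp) hX (by simp [hY]) hu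
  rw [hY] at hq
  have hs := posSemidef_conj hK (X 1)⁻¹
  convert hs using 1
  have e : ((X 1)⁻¹)ᵀ * K * (X 1)⁻¹ = ((X 1)⁻¹)ᵀ * (-(Aᵀ + (1 / 2 : ℝ) • 1) * 0 +
      0 * (-(Aᵀ + (1 / 2 : ℝ) • 1))ᵀ + K - 0 * 0 * 0) * (X 1)⁻¹ := by simp
  rw [e, ← hq]
  simp only [transpose_neg, transpose_add, transpose_transpose, transpose_smul, transpose_one,
    mul_zero, zero_mul, sub_zero, neg_mul, mul_neg, add_mul, mul_add, smul_mul_assoc,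
    mul_smul_comm, one_mul, mul_one]
  generalize Y 1 * (X 1)⁻¹ = Z
  module

end Calculus

/-- An observable Riccati equation with positive definite noise has a supersolution. -/
theorem exists_supersolution {A N : Matrix (Fin n) (Fin n) ℝ}
    {C : Matrix (Fin p) (Fin n) ℝ} {R : Matrix (Fin p) (Fin p) ℝ} (h : IsObservable A C)
    (hR : R.PosDef) (hN : N.PosDef) : ∃ P : Matrix (Fin n) (Fin n) ℝ, P.PosDef ∧
      (-(A * P + P * Aᵀ + N - P * (Cᵀ * R * C) * P)).PosSemidef := by
  obtain ⟨Z, hZ, hcert⟩ := exists_observability_certificate h hR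
  have hK := posSemidef_information (C := C) hR
  set K := Cᵀ * R * C
  have hZs := (posDef_iff.1 hZ).1
  have hB : (Z * N * Z).PosDef := by simpa only [hZs] using posDef_conj hN hZ.isUnit
  have hc := posSemidef_exp_smul_sub hB hZ le_rfl
  have hc1 : 1 ≤ Real.exp (natDist Z (Z * N * Z)) := Real.one_le_exp (natDist_nonneg _ _)
  set c := Real.exp (natDist Z (Z * N * Z))
  -- The constant satisfies `c ≥ 1` and `ZNZ ≤ cZ`. Conjugated by `Z`, the claim is `c²K - cAᵀZ -
  -- cZA - ZNZ ≥ 0`, which is the sum of `(c² - c)K`, `c` times the certificate, and `cZ - ZNZ`.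
  refine ⟨c • Z⁻¹, hZ.inv.smul (by positivity), ?_⟩
  have hi : Z * Z⁻¹ = 1 := mul_nonsing_inv _ ((isUnit_iff_isUnit_det _).1 hZ.isUnit)
  have hj : Z⁻¹ * Z = 1 := nonsing_inv_mul _ ((isUnit_iff_isUnit_det _).1 hZ.isUnit)
  have hs := posSemidef_conj (((hK.smul (by nlinarith : 0 ≤ c * c - c)).add
    (hcert.smul (by positivity : 0 ≤ c))).add hc) Z⁻¹
  rw [transpose_nonsing_inv, hZs] at hs
  convert hs using 1
  have e : ((c * c - c) • K + c • (K - Aᵀ * Z - Z * A - Z) + (c • Z - Z * N * Z)) =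
      (c * c) • K - c • (Aᵀ * Z) - c • (Z * A) - Z * N * Z := by
    rw [sub_smul, smul_sub, smul_sub, smul_sub]; abel
  rw [e]
  simp only [mul_sub, sub_mul, mul_smul_comm, smul_mul_assoc, smul_smul]
  have e1 : Z⁻¹ * (Aᵀ * Z) * Z⁻¹ = Z⁻¹ * Aᵀ := by
    calc _ = Z⁻¹ * Aᵀ * (Z * Z⁻¹) := by noncomm_ring
      _ = _ := by rw [hi, mul_one]
  have e2 : Z⁻¹ * (Z * A) * Z⁻¹ = A * Z⁻¹ := by
    calc _ = (Z⁻¹ * Z) * A * Z⁻¹ := by noncomm_ring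
      _ = _ := by rw [hj, one_mul]
  have e3 : Z⁻¹ * (Z * N * Z) * Z⁻¹ = N := by
    calc _ = (Z⁻¹ * Z) * N * (Z * Z⁻¹) := by noncomm_ring
      _ = _ := by rw [hi, hj, one_mul, mul_one]
  rw [e1, e2, e3]
  abel

/-! ### Compactness and existence of the equilibrium. -/

theorem isClosed_posSemidef : IsClosed {P : Matrix (Fin n) (Fin n) ℝ | P.PosSemidef} := by
  simp only [posSemidef_iff, ofPred_and, ofPred_forall]
  refine (isClosed_eq (by fun_prop) continuous_id).inter (isClosed_iInter fun x => ?_)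
  exact isClosed_le continuous_const (by fun_prop)

/-- Testing the form on `eᵢ ± eⱼ` gives `2|Pᵢⱼ| ≤ Pᵢᵢ + Pⱼⱼ`. -/
theorem abs_apply_le_trace {P : Matrix (Fin n) (Fin n) ℝ} (hP : P.PosSemidef) (i j : Fin n) :
    |P i j| ≤ P.trace := by
  have hd : ∀ i, P i i ≤ P.trace := fun i =>
    Finset.single_le_sum (f := fun i => P i i) (fun i _ => hP.diag_nonneg) (Finset.mem_univ i)
  have hs : P j i = P i j := congrFun (congrFun (posSemidef_iff.1 hP).1 i) j
  have h1 := (posSemidef_iff.1 hP).2 (Pi.single i 1 + Pi.single j 1)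
  have h2 := (posSemidef_iff.1 hP).2 (Pi.single i 1 - Pi.single j 1)
  simp only [mulVec_add, mulVec_sub, dotProduct_add, dotProduct_sub, add_dotProduct,
    sub_dotProduct, mulVec_single_one, single_one_dotProduct, col_apply, hs] at h1 h2
  rw [abs_le]
  constructor <;> linarith [hd i, hd j]

theorem isCompact_abs_le (τ : ℝ) :
    IsCompact {P : Matrix (Fin n) (Fin n) ℝ | ∀ i j, |P i j| ≤ τ} := by
  have := isCompact_univ_pi fun _ : Fin n => isCompact_univ_pi fun _ : Fin n =>
    isCompact_Icc (a := -τ) (b := τ)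
  have e : {P : Matrix (Fin n) (Fin n) ℝ | ∀ i j, |P i j| ≤ τ} =
      univ.pi fun _ : Fin n => univ.pi fun _ : Fin n => Icc (-τ) τ := by
    refine Set.ext fun P => ?_
    simp only [mem_ofPred_eq, abs_le]
    exact ⟨fun h i _ j _ => h i j, fun h i j => h i trivial j trivial⟩
  rw [e]
  exact this

section Calculus

open scoped Matrix.Norms.Operator

/-- Existence for the algebraic Riccati equation, given a supersolution. -/
theorem exists_riccati_eq_zero {A N K P₀ : Matrix (Fin n) (Fin n) ℝ} (hN : N.PosDef)
    (hK : K.PosSemidef) (h₀ : P₀.PosSemidef)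
    (hs : (-(A * P₀ + P₀ * Aᵀ + N - P₀ * K * P₀)).PosSemidef) :
    ∃ Q : Matrix (Fin n) (Fin n) ℝ, Q.PosDef ∧ A * Q + Q * Aᵀ + N - Q * K * Q = 0 := by
  let S : Set (Matrix (Fin n) (Fin n) ℝ) := {P | P.PosSemidef ∧ P.trace ≤ P₀.trace ∧
    (-(A * P + P * Aᵀ + N - P * K * P)).PosSemidef}
  have hSc : IsCompact S := by
    refine (isCompact_abs_le P₀.trace).of_isClosed_subset ?_ fun P hP i j =>
      (abs_apply_le_trace hP.1 i j).trans hP.2.1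
    exact isClosed_posSemidef.inter
      ((isClosed_le (continuous_id.matrix_trace) continuous_const).inter
        (isClosed_posSemidef.preimage (f := fun P => -(A * P + P * Aᵀ + N - P * K * P))
          (by fun_prop)))
  obtain ⟨P, hP, hmin⟩ := hSc.exists_isMinOn ⟨P₀, h₀, le_rfl, hs⟩
    (f := fun P => P.trace) (continuous_id.matrix_trace).continuousOn
  -- On a null vector of `P` the Riccati expression reduces to the form of `N`, which is positive,
  -- contradicting `Φ(P) ≤ 0`.
  have hpd : P.PosDef := by
    refine posDef_iff.2 ⟨(posSemidef_iff.1 hP.1).1, fun x hx =>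
      lt_of_le_of_ne ((posSemidef_iff.1 hP.1).2 x) fun h0 => ?_⟩
    have hPx : P *ᵥ x = 0 := (hP.1.dotProduct_mulVec_zero_iff x).1 (by simpa using h0.symm)
    have hxP : x ᵥ* P = 0 := by
      rw [← mulVec_transpose, (posSemidef_iff.1 hP.1).1, hPx]
    have h1 := (posSemidef_iff.1 hP.2.2).2 x
    have h2 := (posDef_iff.1 hN).2 x hx
    have e1 : x ⬝ᵥ (A * P) *ᵥ x = 0 := by rw [← mulVec_mulVec, hPx, mulVec_zero, dotProduct_zero]
    have e2 : x ⬝ᵥ (P * Aᵀ) *ᵥ x = 0 := by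
      rw [← mulVec_mulVec, dotProduct_mulVec, hxP, zero_dotProduct]
    have e3 : x ⬝ᵥ (P * K * P) *ᵥ x = 0 := by
      rw [← mulVec_mulVec, hPx, mulVec_zero, dotProduct_zero]
    rw [neg_mulVec, dotProduct_neg, sub_mulVec, add_mulVec, add_mulVec, dotProduct_sub,
      dotProduct_add, dotProduct_add, e1, e2, e3] at h1
    linarith
  obtain ⟨X, Y, hXY, hX, hY⟩ := exists_isHamiltonianFlow A N K 1 P
  have hNs := (posDef_iff.1 hN).1
  have hKs := (posSemidef_iff.1 hK).1
  have hu : ∀ t, 0 ≤ t → ((X t)ᵀ * Y t).PosDef := fun t ht =>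
    hXY.posDef_transpose_mul hN.posSemidef hK hX (hY.symm ▸ hpd) ht
  have hneg : ∀ t, 0 ≤ t → (-(A * (Y t * (X t)⁻¹) + (Y t * (X t)⁻¹) * Aᵀ + N -
      (Y t * (X t)⁻¹) * K * (Y t * (X t)⁻¹))).PosSemidef := fun t ht => by
    rw [hXY.quotient_riccati hNs hKs hX (by rw [hY, (posDef_iff.1 hpd).1])
      (IsHamiltonianFlow.isUnit_fst (hu t ht)), hY, ← neg_mul, ← mul_neg]
    exact posSemidef_conj hP.2.2 _
  have hd : ∀ t ∈ Ici (0 : ℝ), HasDerivWithinAt (fun t => (Y t * (X t)⁻¹).trace)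
      (A * (Y t * (X t)⁻¹) + (Y t * (X t)⁻¹) * Aᵀ + N -
      (Y t * (X t)⁻¹) * K * (Y t * (X t)⁻¹)).trace (Ici 0) t := fun t ht =>
    hasDerivWithinAt_trace
      (hXY.hasDerivAt_quotient (IsHamiltonianFlow.isUnit_fst (hu t ht))).hasDerivWithinAt
  have hanti : AntitoneOn (fun t => (Y t * (X t)⁻¹).trace) (Ici 0) := by
    refine antitoneOn_of_hasDerivWithinAt_nonpos (convex_Ici 0)
      (fun t ht => (hd t ht).continuousWithinAt)
      (fun t ht => (hd t (interior_subset ht)).mono interior_subset) fun t ht => ?_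
    have := (hneg t (interior_subset ht)).trace_nonneg
    rw [trace_neg] at this
    linarith
  have h0 : Y 0 * (X 0)⁻¹ = P := by simp [hX, hY]
  -- The flow from the minimizer stays among the competitors, so its trace cannot drop. Hence `tr
  -- Φ(P) = 0`, and `-Φ(P) ≥ 0` forces `Φ(P) = 0`.
  have hconst : ∀ t ∈ Ici (0 : ℝ), (Y t * (X t)⁻¹).trace = P.trace := fun t ht => by
    have h1 : (Y t * (X t)⁻¹).trace ≤ P.trace := by
      simpa only [h0] using hanti (mem_Ici.2 le_rfl) ht ht
    exact le_antisymm h1 (hmin ⟨(IsHamiltonianFlow.posDef_quotient (hu t ht)).posSemidef,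
      h1.trans hP.2.1, hneg t ht⟩)
  have hz := eq_zero_of_hasDerivAt_of_eq_const (uniqueDiffOn_Ici 0) (mem_Ici.2 le_rfl)
    (hd 0 (mem_Ici.2 le_rfl)) hconst
  rw [h0] at hz
  refine ⟨P, hpd, neg_eq_zero.1 (hP.2.2.trace_eq_zero_iff.1 ?_)⟩
  rw [trace_neg, hz, neg_zero]

end Calculus

/-! ### Spectral norm, lowest eigenvalue and balls. -/

theorem continuous_norm2 : Continuous (norm2 : Matrix (Fin n) (Fin n) ℝ → ℝ) :=
  continuous_norm.comp (LinearMap.continuous_of_finiteDimensional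
    (Matrix.toEuclideanCLM (n := Fin n) (𝕜 := ℝ)).toAlgEquiv.toLinearMap)

theorem dotProduct_le_norm2_mul (P : Matrix (Fin n) (Fin n) ℝ) (x : Fin n → ℝ) :
    x ⬝ᵥ (P *ᵥ x) ≤ norm2 P * (x ⬝ᵥ x) := by
  have h := real_inner_le_norm (Matrix.toEuclideanCLM (n := Fin n) (𝕜 := ℝ) P (WithLp.toLp 2 x))
    (WithLp.toLp 2 x)
  have h2 := (Matrix.toEuclideanCLM (n := Fin n) (𝕜 := ℝ) P).le_opNorm (WithLp.toLp 2 x)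
  have e1 : inner ℝ (Matrix.toEuclideanCLM (n := Fin n) (𝕜 := ℝ) P (WithLp.toLp 2 x))
      (WithLp.toLp 2 x) = x ⬝ᵥ (P *ᵥ x) := by
    rw [EuclideanSpace.inner_eq_star_dotProduct]
    simp
  have e2 : x ⬝ᵥ x = ‖WithLp.toLp 2 x‖ * ‖WithLp.toLp 2 x‖ := by
    rw [← real_inner_self_eq_norm_mul_norm, EuclideanSpace.inner_eq_star_dotProduct]
    simp
  rw [e1] at h
  rw [e2, ← mul_assoc]
  exact h.trans (mul_le_mul_of_nonneg_right h2 (norm_nonneg _))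

theorem norm2_pos (hn : 0 < n) {P : Matrix (Fin n) (Fin n) ℝ} (hP : P.PosDef) : 0 < norm2 P := by
  have h := dotProduct_le_norm2_mul P (Pi.single ⟨0, hn⟩ 1)
  have h1 := hP.diag_pos (i := ⟨0, hn⟩)
  simp at h
  linarith

theorem exists_isLeast_spectrum (hn : 0 < n) {N : Matrix (Fin n) (Fin n) ℝ} (hN : N.PosDef) :
    ∃ μ : ℝ, IsLeast (spectrum ℝ N) μ ∧ 0 < μ ∧ (N - μ • 1).PosSemidef := by
  have : Nonempty (Fin n) := ⟨⟨0, hn⟩⟩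
  obtain ⟨i, hi⟩ := Finite.exists_min hN.1.eigenvalues
  refine ⟨hN.1.eigenvalues i, ?_, hN.eigenvalues_pos i, ?_⟩
  · rw [hN.1.spectrum_real_eq_range_eigenvalues]
    exact ⟨mem_range_self i, forall_mem_range.2 hi⟩
  · obtain ⟨U, h1, -, hU⟩ := exists_orthogonal_diagonal hN.1
    have hd : (diagonal fun j => hN.1.eigenvalues j - hN.1.eigenvalues i).PosSemidef :=
      PosSemidef.diagonal fun j => sub_nonneg.2 (hi j)
    have hc := posSemidef_conj hd Uᵀ
    convert hc using 1
    rw [transpose_transpose, ← diagonal_sub, mul_sub, sub_mul, ← hU]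
    congr 1
    rw [← smul_one_eq_diagonal, mul_smul_comm, smul_mul_assoc, mul_one, h1]

/-- Since `P ≤ M·1` and `μ·1 ≤ N`, the multiple `(μ/M) P` lies below `N`; this is the origin of the
rate `μ/M`. -/
theorem posSemidef_sub_smul {N P : Matrix (Fin n) (Fin n) ℝ} {μ M : ℝ} (hμ : 0 ≤ μ) (hM : 0 < M)
    (hN : (N - μ • 1).PosSemidef) (hP : P.PosDef) (hPM : norm2 P ≤ M) :
    (N - (μ / M) • P).PosSemidef := by
  have hPs := (posDef_iff.1 hP).1
  have hNs : Nᵀ = N := by simpa using (posSemidef_iff.1 hN).1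
  refine posSemidef_iff.2 ⟨by rw [transpose_sub, transpose_smul, hPs, hNs], fun x => ?_⟩
  have h1 := (posSemidef_iff.1 hN).2 x
  have h2 := dotProduct_le_norm2_mul P x
  have h3 : 0 ≤ x ⬝ᵥ x := Finset.sum_nonneg fun i _ => mul_self_nonneg _
  have h4 : norm2 P * (x ⬝ᵥ x) ≤ M * (x ⬝ᵥ x) := mul_le_mul_of_nonneg_right hPM h3
  simp only [sub_mulVec, smul_mulVec, dotProduct_sub, dotProduct_smul, one_mulVec,
    smul_eq_mul] at h1 ⊢
  have h5 : μ / M * (x ⬝ᵥ P *ᵥ x) ≤ μ / M * (M * (x ⬝ᵥ x)) :=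
    mul_le_mul_of_nonneg_left (h2.trans h4) (by positivity)
  have h6 : μ / M * (M * (x ⬝ᵥ x)) = μ * (x ⬝ᵥ x) := by field_simp
  linarith

theorem bddAbove_norm2_ballThrough {Q R : Matrix (Fin n) (Fin n) ℝ} (hQ : Q.PosDef) :
    BddAbove (norm2 '' ballThrough Q R) := by
  suffices h : ballThrough Q R ⊆ {P | ∀ i j, |P i j| ≤ Real.exp (natDist Q R) * Q.trace} from
    ((isCompact_abs_le _).image continuous_norm2).bddAbove.mono (image_mono h)
  intro P hP i j
  refine (abs_apply_le_trace hP.1.posSemidef i j).trans ?_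
  -- On the ball `P ≤ e^r Q` in the Loewner order, so the trace, and with it every entry, is
  -- bounded.
  have := (posSemidef_exp_smul_sub hP.1 hQ hP.2).trace_nonneg
  rw [trace_sub, trace_smul, smul_eq_mul] at this
  linarith

theorem self_mem_ballThrough {Q R : Matrix (Fin n) (Fin n) ℝ} (hQ : Q.PosDef) :
    Q ∈ ballThrough Q R := ⟨hQ, by rw [natDist_self hQ]; exact natDist_nonneg _ _⟩

theorem exists_isLUB_norm2 (hn : 0 < n) {Q R : Matrix (Fin n) (Fin n) ℝ} (hQ : Q.PosDef) :
    ∃ M, IsLUB (norm2 '' ballThrough Q R) M ∧ 0 < M := by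
  have hmem : Q ∈ ballThrough Q R := self_mem_ballThrough hQ
  have hl := isLUB_csSup ⟨_, mem_image_of_mem norm2 hmem⟩
    (bddAbove_norm2_ballThrough (R := R) hQ)
  exact ⟨_, hl, (norm2_pos hn hQ).trans_le (hl.1 (mem_image_of_mem norm2 hmem))⟩

theorem riccati_eq (A : Matrix (Fin n) (Fin n) ℝ) (C : Matrix (Fin p) (Fin n) ℝ)
    (G : Matrix (Fin n) (Fin m) ℝ) (H : Matrix (Fin p) (Fin p) ℝ) (P : Matrix (Fin n) (Fin n) ℝ) :
    riccati A C G H P = A * P + P * Aᵀ + G * Gᵀ - P * (Cᵀ * (H * Hᵀ)⁻¹ * C) * P := by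
  simp only [riccati, Matrix.mul_assoc]

/-! ### Invariance, global existence and contraction of the Riccati flow. -/

section Calculus

open scoped Matrix.Norms.Operator

section Flow

variable {A N K : Matrix (Fin n) (Fin n) ℝ} {J : Set ℝ}

/-- Positivity is required only at time zero: the solution must coincide with the Hamiltonian
quotient, which never leaves the cone. -/
theorem posDef_of_hasDerivWithinAt (hN : N.PosSemidef) (hK : K.PosSemidef)
    {P : ℝ → Matrix (Fin n) (Fin n) ℝ} {b : ℝ} (hP : ∀ t ∈ Icc 0 b,
      HasDerivWithinAt P (A * P t + P t * Aᵀ + N - P t * K * P t) (Icc 0 b) t)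
    (h0 : (P 0).PosDef) {t : ℝ} (ht : t ∈ Icc 0 b) : (P t).PosDef := by
  obtain ⟨X, Y, hXY, hX, hY⟩ := exists_isHamiltonianFlow A N K 1 (P 0)
  have hu := hXY.posDef_transpose_mul hN hK hX (hY.symm ▸ h0) ht.1
  rw [eq_quotient_of_hasDerivWithinAt hXY hX hY.symm hP ht (IsHamiltonianFlow.isUnit_fst hu)]
  exact IsHamiltonianFlow.posDef_quotient hu

theorem exists_hasDerivWithinAt (hN : N.PosSemidef) (hK : K.PosSemidef)
    {P₀ : Matrix (Fin n) (Fin n) ℝ} (h0 : P₀.PosDef) :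
    ∃ P : ℝ → Matrix (Fin n) (Fin n) ℝ, P 0 = P₀ ∧ ∀ t ∈ Ici 0,
      HasDerivWithinAt P (A * P t + P t * Aᵀ + N - P t * K * P t) (Ici 0) t := by
  obtain ⟨X, Y, hXY, hX, hY⟩ := exists_isHamiltonianFlow A N K 1 P₀
  refine ⟨fun t => Y t * (X t)⁻¹, by simp [hX, hY], fun t ht => ?_⟩
  have hu := hXY.posDef_transpose_mul hN hK hX (hY.symm ▸ h0) ht
  exact (hXY.hasDerivAt_quotient (IsHamiltonianFlow.isUnit_fst hu)).hasDerivWithinAt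

theorem hasDerivWithinAt_const_of_riccati_eq_zero {Q : Matrix (Fin n) (Fin n) ℝ}
    (hQ : A * Q + Q * Aᵀ + N - Q * K * Q = 0) (t : ℝ) :
    HasDerivWithinAt (fun _ => Q) (A * Q + Q * Aᵀ + N - Q * K * Q) J t := by
  rw [hQ]
  exact hasDerivWithinAt_const t J Q

/-- Balls around the equilibrium are invariant. -/
theorem mem_ballThrough_of_hasDerivWithinAt (hN : N.PosSemidef) (hK : K.PosSemidef)
    {P : ℝ → Matrix (Fin n) (Fin n) ℝ} {Q R : Matrix (Fin n) (Fin n) ℝ} (hQ : Q.PosDef)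
    (hQ0 : A * Q + Q * Aᵀ + N - Q * K * Q = 0) {b : ℝ} (hP : ∀ t ∈ Icc 0 b,
      HasDerivWithinAt P (A * P t + P t * Aᵀ + N - P t * K * P t) (Icc 0 b) t)
    (h0 : P 0 ∈ ballThrough Q R) {t : ℝ} (ht : t ∈ Icc 0 b) : P t ∈ ballThrough Q R := by
  have hpd : ∀ s ∈ Icc 0 b, (P s).PosDef := fun s hs =>
    posDef_of_hasDerivWithinAt hN hK hP h0.1 hs
  have hsub : Icc 0 t ⊆ Icc 0 b := Icc_subset_Icc_right ht.2
  refine ⟨hpd t ht, ?_⟩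
  -- Rate `c = 0` against the constant solution `Q`: the distance to `Q` does not increase, and the
  -- Loewner hypotheses reduce to `N ≥ 0`.
  have := natDist_le_exp_mul hK le_rfl ht.1 (P₁ := fun _ => Q) (P₂ := P)
    (fun s _ => hasDerivWithinAt_const_of_riccati_eq_zero hQ0 s)
    (fun s hs => (hP s (hsub hs)).mono hsub) (fun _ _ => hQ) (fun s hs => hpd s (hsub hs))
    (fun _ _ => by simpa using hN) (fun _ _ => by simpa using hN)
  rw [neg_zero, zero_mul, Real.exp_zero, one_mul] at this
  exact this.trans h0.2

theorem natDist_le_exp_of_mem_ballThrough (hK : K.PosSemidef) {P₁ P₂ : ℝ → Matrix (Fin n) (Fin n) ℝ}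
    {Q R : Matrix (Fin n) (Fin n) ℝ} (hQ : Q.PosDef)
    (hQ0 : A * Q + Q * Aᵀ + N - Q * K * Q = 0) {μ M : ℝ} (hμ : 0 < μ) (hM : 0 < M)
    (hN : N.PosDef) (hNμ : (N - μ • 1).PosSemidef)
    (hlub : IsLUB (norm2 '' ballThrough Q R) M) {b : ℝ} (hb : 0 ≤ b)
    (h₁ : ∀ t ∈ Icc 0 b,
      HasDerivWithinAt P₁ (A * P₁ t + P₁ t * Aᵀ + N - P₁ t * K * P₁ t) (Icc 0 b) t)
    (h₂ : ∀ t ∈ Icc 0 b,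
      HasDerivWithinAt P₂ (A * P₂ t + P₂ t * Aᵀ + N - P₂ t * K * P₂ t) (Icc 0 b) t)
    (i₁ : P₁ 0 ∈ ballThrough Q R) (i₂ : P₂ 0 ∈ ballThrough Q R) :
    P₁ b ∈ ballThrough Q R ∧ P₂ b ∈ ballThrough Q R ∧
      natDist (P₁ b) (P₂ b) ≤ Real.exp (-(μ / M) * b) * natDist (P₁ 0) (P₂ 0) := by
  have hm₁ : ∀ t ∈ Icc 0 b, P₁ t ∈ ballThrough Q R := fun t ht =>
    mem_ballThrough_of_hasDerivWithinAt hN.posSemidef hK hQ hQ0 h₁ i₁ ht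
  have hm₂ : ∀ t ∈ Icc 0 b, P₂ t ∈ ballThrough Q R := fun t ht =>
    mem_ballThrough_of_hasDerivWithinAt hN.posSemidef hK hQ hQ0 h₂ i₂ ht
  have hbd : ∀ S ∈ ballThrough Q R, (N - (μ / M) • S).PosSemidef := fun S hS =>
    posSemidef_sub_smul hμ.le hM hNμ hS.1 (hlub.1 (mem_image_of_mem norm2 hS))
  have hbb : b ∈ Icc 0 b := right_mem_Icc.2 hb
  exact ⟨hm₁ b hbb, hm₂ b hbb, natDist_le_exp_mul hK (by positivity) hb h₁ h₂
    (fun t ht => (hm₁ t ht).1) (fun t ht => (hm₂ t ht).1) (fun t ht => hbd _ (hm₁ t ht))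
    (fun t ht => hbd _ (hm₂ t ht))⟩

end Flow

variable {A : Matrix (Fin n) (Fin n) ℝ} {C : Matrix (Fin p) (Fin n) ℝ}
  {G : Matrix (Fin n) (Fin m) ℝ} {H : Matrix (Fin p) (Fin p) ℝ}

theorem isRiccatiSolutionOn_iff {P : ℝ → Matrix (Fin n) (Fin n) ℝ} {J : Set ℝ} :
    IsRiccatiSolutionOn A C G H P J ↔ ∀ t ∈ J, HasDerivWithinAt P
      (A * P t + P t * Aᵀ + G * Gᵀ - P t * (Cᵀ * (H * Hᵀ)⁻¹ * C) * P t) J t := by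
  simp only [IsRiccatiSolutionOn, ← riccati_eq]
  exact forall₂_congr fun t _ => hasDerivWithinAt_matrix.symm

theorem IsRiccatiSolutionOn.mono {P : ℝ → Matrix (Fin n) (Fin n) ℝ} {J J' : Set ℝ}
    (h : IsRiccatiSolutionOn A C G H P J) (hJ : J' ⊆ J) : IsRiccatiSolutionOn A C G H P J' :=
  fun t ht i j => (h t (hJ ht) i j).mono hJ

theorem exists_isRiccatiSolutionOn (hN : (G * Gᵀ).PosSemidef) (hR : (H * Hᵀ).PosDef)
    {P₀ : Matrix (Fin n) (Fin n) ℝ} (h0 : P₀.PosDef) :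
    ∃ P, IsRiccatiSolutionOn A C G H P (Ici 0) ∧ P 0 = P₀ := by
  obtain ⟨P, hP0, hP⟩ := exists_hasDerivWithinAt (A := A) hN
    (posSemidef_information (C := C) hR.inv) h0
  exact ⟨P, isRiccatiSolutionOn_iff.2 hP, hP0⟩

theorem isRiccatiSolutionOn_const {Q : Matrix (Fin n) (Fin n) ℝ} (hQ : riccati A C G H Q = 0)
    (J : Set ℝ) : IsRiccatiSolutionOn A C G H (fun _ => Q) J := by
  rw [riccati_eq] at hQ
  exact isRiccatiSolutionOn_iff.2 fun t _ => hasDerivWithinAt_const_of_riccati_eq_zero hQ t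

theorem IsRiccatiSolutionOn.contraction (hN : (G * Gᵀ).PosDef) (hR : (H * Hᵀ).PosDef)
    {Q R : Matrix (Fin n) (Fin n) ℝ} (hQ : Q.PosDef) (hQ0 : riccati A C G H Q = 0) {μ M : ℝ}
    (hμ : 0 < μ) (hM : 0 < M) (hNμ : (G * Gᵀ - μ • 1).PosSemidef)
    (hlub : IsLUB (norm2 '' ballThrough Q R) M) {J : Set ℝ} (hJ : J.OrdConnected)
    (h0J : (0 : ℝ) ∈ J) {P₁ P₂ : ℝ → Matrix (Fin n) (Fin n) ℝ}
    (h₁ : IsRiccatiSolutionOn A C G H P₁ J) (h₂ : IsRiccatiSolutionOn A C G H P₂ J)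
    (i₁ : P₁ 0 ∈ ballThrough Q R) (i₂ : P₂ 0 ∈ ballThrough Q R) {t : ℝ} (ht0 : 0 ≤ t)
    (ht : t ∈ J) : P₁ t ∈ ballThrough Q R ∧ P₂ t ∈ ballThrough Q R ∧
      natDist (P₁ t) (P₂ t) ≤ Real.exp (-(μ / M) * t) * natDist (P₁ 0) (P₂ 0) := by
  rw [riccati_eq] at hQ0
  have hsub : Icc 0 t ⊆ J := hJ.out h0J ht
  exact natDist_le_exp_of_mem_ballThrough (posSemidef_information (C := C) hR.inv) hQ hQ0 hμ hM hN
    hNμ hlub ht0 (isRiccatiSolutionOn_iff.1 (h₁.mono hsub))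
    (isRiccatiSolutionOn_iff.1 (h₂.mono hsub)) i₁ i₂

end Calculus

end KalmanRiccati

/-! ### Assembly. -/

theorem proposition1 (n m p : ℕ) (hn : 0 < n)
    (A : Matrix (Fin n) (Fin n) ℝ) (C : Matrix (Fin p) (Fin n) ℝ)
    (G : Matrix (Fin n) (Fin m) ℝ) (H : Matrix (Fin p) (Fin p) ℝ)
    (hH : IsUnit (H * H.transpose))
    (hobs : KalmanRiccati.IsObservable A C)
    (hG : G.rank = n) :
    -- existence and uniqueness for the algebraic Riccati equation
    (∃! Q, Q ∈ KalmanRiccati.posCone n ∧ KalmanRiccati.riccati A C G H Q = 0) ∧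
    -- the Riccati flow is defined on `P_+(n)` for all nonnegative times
    (∀ P₀ ∈ KalmanRiccati.posCone n, ∃ P : ℝ → Matrix (Fin n) (Fin n) ℝ,
      KalmanRiccati.IsRiccatiSolutionOn A C G H P (Set.Ici 0) ∧ P 0 = P₀) ∧
    -- `μ` is the lowest eigenvalue of `G G'`, and `Q` the solution of the algebraic equation
    ∃ μ : ℝ, IsLeast (spectrum ℝ (G * G.transpose)) μ ∧ 0 < μ ∧
    ∀ Q ∈ KalmanRiccati.posCone n, KalmanRiccati.riccati A C G H Q = 0 →
      (∀ R ∈ KalmanRiccati.posCone n,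
        -- `M` is the (finite) supremum of `‖P‖₂` over the ball `S_R`
        ∃ M : ℝ, IsLUB (KalmanRiccati.norm2 '' KalmanRiccati.ballThrough Q R) M ∧ 0 < M ∧
          -- solutions on any time interval `J` that starts at `0`
          ∀ J : Set ℝ, J.OrdConnected → J ⊆ Set.Ici 0 → (0 : ℝ) ∈ J →
          ∀ P₁ P₂ : ℝ → Matrix (Fin n) (Fin n) ℝ,
            KalmanRiccati.IsRiccatiSolutionOn A C G H P₁ J →
            KalmanRiccati.IsRiccatiSolutionOn A C G H P₂ J →
            P₁ 0 ∈ KalmanRiccati.ballThrough Q R →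
            P₂ 0 ∈ KalmanRiccati.ballThrough Q R →
            ∀ t ∈ J,
              P₁ t ∈ KalmanRiccati.ballThrough Q R ∧
              P₂ t ∈ KalmanRiccati.ballThrough Q R ∧
              KalmanRiccati.natDist (P₁ t) (P₂ t) ≤
                Real.exp (-(μ / M) * t) * KalmanRiccati.natDist (P₁ 0) (P₂ 0)) ∧
      -- every solution started in `P_+(n)` converges exponentially to `Q`
      (∀ P : ℝ → Matrix (Fin n) (Fin n) ℝ,
        KalmanRiccati.IsRiccatiSolutionOn A C G H P (Set.Ici 0) →
        P 0 ∈ KalmanRiccati.posCone n →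
        ∃ κ : ℝ, 0 < κ ∧ ∀ t : ℝ, 0 ≤ t →
          P t ∈ KalmanRiccati.posCone n ∧
          KalmanRiccati.natDist (P t) Q ≤
            Real.exp (-κ * t) * KalmanRiccati.natDist (P 0) Q) := by
  have hN := KalmanRiccati.posDef_mul_transpose_of_rank hG
  have hR := KalmanRiccati.posDef_mul_transpose_of_isUnit hH
  obtain ⟨μ, hμ, hμ0, hNμ⟩ := KalmanRiccati.exists_isLeast_spectrum hn hN
  refine ⟨?_, fun P₀ hP₀ => KalmanRiccati.exists_isRiccatiSolutionOn hN.posSemidef hR hP₀,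
    μ, hμ, hμ0, fun Q hQ hQ0 => ⟨fun R _ => ?_, fun P hP hP0 => ?_⟩⟩
  · obtain ⟨P₀, hP₀, hs⟩ := KalmanRiccati.exists_supersolution hobs hR.inv hN
    obtain ⟨Q, hQ, hQ0⟩ := KalmanRiccati.exists_riccati_eq_zero hN
      (KalmanRiccati.posSemidef_information hR.inv) hP₀.posSemidef hs
    rw [← KalmanRiccati.riccati_eq] at hQ0
    refine ⟨Q, ⟨hQ, hQ0⟩, fun S ⟨hS, hS0⟩ => ?_⟩
    -- For uniqueness, the ball through the second equilibrium `S` contains both. Contraction of the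
    -- two constant solutions up to time one gives `d ≤ e^{-μ/M} d`, so `d = 0`.
    obtain ⟨M, hM, hM0⟩ := KalmanRiccati.exists_isLUB_norm2 (R := S) hn hQ
    obtain ⟨-, -, h⟩ := KalmanRiccati.IsRiccatiSolutionOn.contraction hN hR hQ hQ0 hμ0 hM0 hNμ hM
      Set.ordConnected_Ici Set.self_mem_Ici
      (KalmanRiccati.isRiccatiSolutionOn_const hS0 (Set.Ici 0))
      (KalmanRiccati.isRiccatiSolutionOn_const hQ0 (Set.Ici 0))
      ⟨hS, le_rfl⟩ (KalmanRiccati.self_mem_ballThrough hQ) zero_le_one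
      (Set.mem_Ici.2 zero_le_one)
    refine KalmanRiccati.eq_of_natDist_eq_zero hS hQ
      (le_antisymm ?_ (KalmanRiccati.natDist_nonneg _ _))
    have hlt : Real.exp (-(μ / M) * 1) < 1 := Real.exp_lt_one_iff.2 (by
      have := div_pos hμ0 hM0
      linarith)
    nlinarith [KalmanRiccati.natDist_nonneg S Q]
  · obtain ⟨M, hM, hM0⟩ := KalmanRiccati.exists_isLUB_norm2 (R := R) hn hQ
    exact ⟨M, hM, hM0, fun J hJ hJ0 h0J P₁ P₂ h₁ h₂ i₁ i₂ t ht =>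
      h₁.contraction hN hR hQ hQ0 hμ0 hM0 hNμ hM hJ h0J h₂ i₁ i₂ (hJ0 ht) ht⟩
  · obtain ⟨M, hM, hM0⟩ := KalmanRiccati.exists_isLUB_norm2 (R := P 0) hn hQ
    refine ⟨μ / M, div_pos hμ0 hM0, fun t ht => ?_⟩
    obtain ⟨h1, -, h3⟩ := hP.contraction hN hR hQ hQ0 hμ0 hM0 hNμ hM Set.ordConnected_Ici
      Set.self_mem_Ici (KalmanRiccati.isRiccatiSolutionOn_const hQ0 (Set.Ici 0))
      ⟨hP0, le_rfl⟩ (KalmanRiccati.self_mem_ballThrough hQ) ht (Set.mem_Ici.2 ht)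
    exact ⟨h1.1, h3⟩
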